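/- Notation: $e(\theta)=e^{2\pi i\theta}$, and $y\sim Y$ means that $y$ is an integer with $Y<y\le 2Y$. There is an absolute constant $\varepsilon_0>0$ such that for every $0<\varepsilon<\varepsilon_0$ and every $A>0$ there is a constant $C=C(\varepsilon,A)>0$ with the following property. Put $\eta=\varepsilon^9$. Let $\frac16<\rho<\frac2{11}$, let $a/q$ be a fraction in lowest terms ($a\in\mathbb Z$, $q\ge1$), let $\beta,\gamma$ be real and let $$g(x)=\frac aq\,x^2+\beta x+\gamma .$$ Let $N\ge 1$ be a real number, put $L_1=2N^{\rho-\varepsilon/2}$ and $L=N^{\rho-\varepsilon/3}$, and suppose that $$A^{-1}L_1^{1/2}N\le q\le A\,L_1^{1/2}N .$$ Let $V\ge1$ and $W\ge1$ be real numbers with $$V^3W^2\le A\,N^{2-3\rho},\qquad VW^3\le A\,N^{3-15\rho/2},\qquad VW\le A\,N^{2-8\rho}.$$ For each positive integer $m$ let $I(m)$ be an arbitrary subinterval of $\left(\frac N{2m},\frac Nm\right]$. Then $$\sum_{1\le\ell\le L}\ \sum_{v\sim V}\ \sum_{w\sim W}\ \Bigl|\sum_{n\in I(vw)}e\bigl(\ell\,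 g(vwn)\bigr)\Bigr|\le C\,N^{1-10\eta}.$$ -/

import Mathlib

namespace TypeI

/-- `e(θ) = exp(2πiθ)`. -/
noncomputable def e (θ : ℝ) : ℂ := Complex.exp (2 * Real.pi * Complex.I * θ)

/-- The quadratic polynomial `g(x) = (a/q) x² + β x + γ`. -/
noncomputable def g (a : ℤ) (q : ℕ) (β γ : ℝ) (x : ℝ) : ℝ :=
  (a : ℝ) / (q : ℝ) * x ^ 2 + β * x + γ

/-- The positive integers `y` with `y ∼ Y`, that is, `Y < y ≤ 2Y`. -/
noncomputable def dyadic (Y : ℝ) : Finset ℕ := Finset.Ioc ⌊Y⌋₊ ⌊2 * Y⌋₊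

theorem mem_dyadic {Y : ℝ} (hY : 0 ≤ Y) (y : ℕ) :
    y ∈ dyadic Y ↔ Y < (y : ℝ) ∧ (y : ℝ) ≤ 2 * Y := by
  rw [dyadic, Finset.mem_Ioc, Nat.floor_lt hY, Nat.le_floor_iff (by positivity)]

/-- `I` assigns to every positive integer `m` a subinterval `I(m)` of `(N/(2m), N/m]`
(of any kind, possibly empty). -/
def IsSubintervalFamily (N : ℝ) (I : ℕ → Set ℝ) : Prop :=
  ∀ m : ℕ, 0 < m → (I m).OrdConnected ∧ I m ⊆ Set.Ioc (N / (2 * (m : ℝ))) (N / (m : ℝ))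

open Classical in
/-- The integers `n` in `I(m)`, for a family of subintervals of `(N/(2m), N/m]`. -/
noncomputable def integersIn (N : ℝ) (I : ℕ → Set ℝ) (m : ℕ) : Finset ℕ :=
  (Finset.Icc 1 ⌊N / (m : ℝ)⌋₊).filter (fun n : ℕ => (n : ℝ) ∈ I m)

theorem mem_integersIn {N : ℝ} (hN : 0 ≤ N) {I : ℕ → Set ℝ} (hI : IsSubintervalFamily N I)
    {m : ℕ} (hm : 0 < m) (n : ℕ) : n ∈ integersIn N I m ↔ (n : ℝ) ∈ I m := by
  classical
  simp only [integersIn, Finset.mem_filter, Finset.mem_Icc]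
  refine ⟨fun h => h.2, fun h => ⟨⟨?_, ?_⟩, h⟩⟩
  · have h1 : (0 : ℝ) < n := lt_of_le_of_lt (by positivity) ((hI m hm).2 h).1
    exact_mod_cast h1
  · exact Nat.le_floor ((hI m hm).2 h).2

/-- `T = ∑_{1 ≤ ℓ ≤ L} ∑_{v ∼ V} ∑_{w ∼ W} |∑_{n ∈ I(vw)} e(ℓ g(vwn))|`. -/
noncomputable def T (a : ℤ) (q : ℕ) (β γ N L V W : ℝ) (I : ℕ → Set ℝ) : ℝ :=
  ∑ l ∈ Finset.Icc 1 ⌊L⌋₊, ∑ v ∈ dyadic V, ∑ w ∈ dyadic W,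
    ‖∑ n ∈ integersIn N I (v * w),
      e ((l : ℝ) * g a q β γ ((v : ℝ) * (w : ℝ) * (n : ℝ)))‖

end TypeI

/-!
Put `H = N / (VW)` and `D = L H²`. Weyl differencing, Cauchy–Schwarz over `ℓ ≤ L` and the divisor
bound reduce the sum attached to a pair `(v, w)` to counting the `k` of size `L H` for which
`k (vw)² a/q` is close to an integer. If `u/t` is a Dirichlet approximation to `x = (vw)² a/q`,
with height `Y = max t (D |t x - u|)`, that sum is essentially at most `L H / √Y`, so what has to
be bounded is the number of pairs of height at most `Y`, for every `Y` up to about `L²`.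

Fix `w` and let `v` vary. The integers `t v²` are near-multiples of `w² a/q`. Either these are few,
as for a generic number, or one fraction `r₀` governs all of them, and every `u/t` equals `v² r₀`.
In the latter case `r₀` has a denominator `k = t c` such that `c` divides the squares `v²`, which
leaves about `V / √c` values of `v`, and `k w² a/q` is close to an integer. If the same `k` serves
both `w` and `w'`, then `k (w'² - w²) a/q` is close to an integer as well; since `q` is large this
is rare, and so few `w` have small `c`.
-/

namespace TypeI

open Finset

/-! ### Near-multiples and rational approximation -/

theorem sum_comp_le_mul_sum {ι κ : Type*} [DecidableEq κ] {s : Finset ι} {t : Finset κ}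
    {f : ι → κ} (hf : ∀ x ∈ s, f x ∈ t) {B : κ → ℝ} (hB : ∀ y ∈ t, 0 ≤ B y) {τ : ℝ}
    (hτ : ∀ y ∈ t, (#{x ∈ s | f x = y} : ℝ) ≤ τ) :
    ∑ x ∈ s, B (f x) ≤ τ * ∑ y ∈ t, B y := by
  rw [← sum_fiberwise_of_maps_to hf, mul_sum]
  refine sum_le_sum fun y hy => ?_
  calc ∑ x ∈ s with f x = y, B (f x) = #{x ∈ s | f x = y} * B y := by
        rw [sum_congr rfl fun x hx => by rw [(mem_filter.1 hx).2], sum_const, nsmul_eq_mul]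
    _ ≤ τ * B y := mul_le_mul_of_nonneg_right (hτ y hy) (hB y hy)

theorem card_le_mul_card {ι κ : Type*} [DecidableEq κ] {s : Finset ι} {t : Finset κ}
    {f : ι → κ} (hf : ∀ x ∈ s, f x ∈ t) {τ : ℝ}
    (hτ : ∀ y ∈ t, (#{x ∈ s | f x = y} : ℝ) ≤ τ) : (#s : ℝ) ≤ τ * #t := by
  simpa using sum_comp_le_mul_sum hf (B := fun _ => 1) (fun _ _ => zero_le_one) hτ

/-- The distance `‖x‖` from `x` to the nearest integer. -/
noncomputable def distInt (x : ℝ) : ℝ := |x - round x|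

theorem distInt_le (x : ℝ) (z : ℤ) : distInt x ≤ |x - z| := round_le x z

theorem distInt_le_half (x : ℝ) : distInt x ≤ 1 / 2 := abs_sub_round x

theorem distInt_sub_le (x y : ℝ) : distInt (x - y) ≤ distInt x + distInt y :=
  calc distInt (x - y) ≤ |x - y - ((round x - round y : ℤ) : ℝ)| := distInt_le _ _
    _ = |(x - round x) - (y - round y)| := by push_cast; ring_nf
    _ ≤ distInt x + distInt y := abs_sub _ _

/-- The positive integers `k ≤ K` with `‖kx‖ ≤ δ`. -/
noncomputable def nearMultiples (x δ : ℝ) (K : ℕ) : Finset ℕ :=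
  (Icc 1 K).filter fun k : ℕ => distInt (k * x) ≤ δ

theorem mem_nearMultiples {x δ : ℝ} {K k : ℕ} :
    k ∈ nearMultiples x δ K ↔ (1 ≤ k ∧ k ≤ K) ∧ distInt (k * x) ≤ δ := by
  rw [nearMultiples, mem_filter, mem_Icc]

theorem one_le_den_mul_abs_sub {r : ℚ} {k z : ℤ} (h : k * r ≠ z) :
    1 ≤ (r.den : ℝ) * |(k : ℝ) * r - z| := by
  have hden : (r.den : ℝ) ≠ 0 := Nat.cast_ne_zero.2 r.den_nz
  have hne : k * r.num - z * r.den ≠ 0 := fun h0 => h <| by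
    have : (k : ℚ) * r.num = z * r.den := by exact_mod_cast sub_eq_zero.1 h0
    rw [← Rat.num_div_den r, mul_div_assoc', this, mul_div_cancel_right₀]
    exact_mod_cast r.den_nz
  calc (1 : ℝ) ≤ |((k * r.num - z * r.den : ℤ) : ℝ)| := by exact_mod_cast Int.one_le_abs hne
    _ = |(r.den : ℝ) * ((k : ℝ) * r - z)| := by
      rw [Rat.cast_def]
      push_cast
      congr 1
      field_simp
    _ = (r.den : ℝ) * |(k : ℝ) * r - z| := by rw [abs_mul, Nat.abs_cast]

theorem isCoprime_num_den (r : ℚ) : IsCoprime (r.den : ℤ) r.num :=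
  IsCoprime.symm (Int.isCoprime_iff_gcd_eq_one.2 r.reduced)

theorem den_dvd_of_mul_eq_intCast {r : ℚ} {k z : ℤ} (h : k * r = z) : (r.den : ℤ) ∣ k := by
  have hnum : k * r.num = z * r.den := by
    rw [← Rat.num_div_den r, mul_div_assoc', div_eq_iff (by exact_mod_cast r.den_nz)] at h
    exact_mod_cast h
  exact (isCoprime_num_den r).dvd_of_dvd_mul_right ⟨z, by rw [hnum, mul_comm]⟩

theorem card_nearMultiples_ratCast_le (r : ℚ) (K : ℕ) {δ : ℝ} (hδ : 0 ≤ δ) :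
    (#(nearMultiples r δ K) : ℝ) ≤ ((K : ℝ) / r.den + 1) * (2 * r.den * δ + 1) := by
  set M := ⌊(r.den : ℝ) * δ⌋₊
  have hcard : #(nearMultiples r δ K) ≤ #(range (K / r.den + 1) ×ˢ Icc (-(M : ℤ)) M) := by
    refine card_le_card_of_injOn
      (fun k => (k / r.den, k * r.num - round ((k : ℝ) * (r : ℝ)) * r.den)) (fun k hk => ?_) ?_
    · obtain ⟨⟨-, hkK⟩, hkδ⟩ := mem_nearMultiples.1 hk
      have habs : |(((k * r.num - round ((k : ℝ) * (r : ℝ)) * r.den : ℤ)) : ℝ)| ≤ r.den * δ := by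
        calc _ = |(r.den : ℝ) * ((k : ℝ) * r - round ((k : ℝ) * (r : ℝ)))| := by
              rw [mul_sub, mul_left_comm, ← Rat.cast_natCast r.den, ← Rat.cast_mul,
                Rat.den_mul_eq_num]
              push_cast
              ring_nf
          _ ≤ r.den * δ := by rw [abs_mul, Nat.abs_cast]; gcongr; exact hkδ
      have hcM : |k * r.num - round ((k : ℝ) * (r : ℝ)) * r.den| ≤ M := by
        rw [Int.natCast_floor_eq_floor (by positivity), Int.le_floor, Int.cast_abs]
        exact habs
      simpa [Nat.lt_succ_iff, abs_le] using And.intro (Nat.div_le_div_right hkK) (abs_le.1 hcM)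
    · intro k _ k' _ h
      obtain ⟨hdiv, hnum⟩ := Prod.mk.inj h
      have hdvd : (r.den : ℤ) ∣ k' - k := (isCoprime_num_den r).dvd_of_dvd_mul_right
        ⟨round ((k' : ℝ) * (r : ℝ)) - round ((k : ℝ) * (r : ℝ)), by linear_combination -hnum⟩
      have hmod : k % r.den = k' % r.den := Nat.modEq_iff_dvd.2 hdvd
      rw [← Nat.div_add_mod k r.den, ← Nat.div_add_mod k' r.den, hdiv, hmod]
  calc (#(nearMultiples r δ K) : ℝ)
      ≤ (((K / r.den + 1) * (2 * M + 1) : ℕ) : ℝ) := by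
        refine Nat.cast_le.2 (hcard.trans_eq ?_)
        rw [card_product, card_range, Int.card_Icc]
        congr 1
        omega
    _ = (((K / r.den : ℕ) : ℝ) + 1) * (2 * M + 1) := by push_cast; ring
    _ ≤ ((K : ℝ) / r.den + 1) * (2 * (r.den * δ) + 1) := by
      gcongr
      · exact Nat.cast_div_le
      · exact Nat.floor_le (by positivity)
    _ = ((K : ℝ) / r.den + 1) * (2 * r.den * δ + 1) := by ring

/-- `r` is a rational approximation to `x` of the quality that Dirichlet's theorem provides with
denominators up to `n`. -/
structure IsDirichletApprox (x : ℝ) (n : ℕ) (r : ℚ) : Prop where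
  den_le : r.den ≤ n
  den_mul_abs_sub_le : r.den * |x - r| ≤ 1 / n

theorem exists_isDirichletApprox (x : ℝ) {n : ℕ} (hn : 0 < n) :
    ∃ r : ℚ, IsDirichletApprox x n r := by
  obtain ⟨r, hr, hden⟩ := Real.exists_rat_abs_sub_le_and_den_le x hn
  have : (0 : ℝ) < r.den := Nat.cast_pos.2 r.pos
  refine ⟨r, hden, ?_⟩
  calc (r.den : ℝ) * |x - r| ≤ r.den * (1 / ((n + 1) * r.den)) := by gcongr
    _ = 1 / (n + 1) := by field_simp
    _ ≤ 1 / n := by gcongr; linarith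

namespace IsDirichletApprox

variable {x δ : ℝ} {K : ℕ} {r : ℚ}

theorem pos (hr : IsDirichletApprox x (2 * K) r) : 0 < K := by
  have := r.pos.trans_le hr.den_le
  omega

theorem mul_abs_sub_le (hr : IsDirichletApprox x (2 * K) r) {k : ℕ} (hk : k ≤ K) :
    k * |x - r| ≤ 1 / (2 * r.den) := by
  have hden : (0 : ℝ) < r.den := Nat.cast_pos.2 r.pos
  have hK : (0 : ℝ) < K := Nat.cast_pos.2 hr.pos
  have hkK : (k : ℝ) ≤ K := Nat.cast_le.2 hk
  have hx : |x - r| ≤ 1 / (2 * K) / r.den := by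
    rw [le_div_iff₀' hden]
    exact_mod_cast hr.den_mul_abs_sub_le
  calc k * |x - r| ≤ K * (1 / (2 * K) / r.den) := by gcongr
    _ = 1 / (2 * r.den) := by field_simp

theorem abs_mul_sub_mul_le (hr : IsDirichletApprox x (2 * K) r) {k : ℕ} (hk : k ≤ K) :
    |k * x - k * r| ≤ 1 / (2 * r.den) := by
  rw [← mul_sub, abs_mul, Nat.abs_cast]
  exact hr.mul_abs_sub_le hk

theorem card_nearMultiples_le (hr : IsDirichletApprox x (2 * K) r) (hδ : 1 / (2 * r.den) ≤ δ) :
    (#(nearMultiples x δ K) : ℝ) ≤ 18 * K * δ := by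
  have : (0 : ℝ) < r.den := Nat.cast_pos.2 r.pos
  have hδ0 : 0 ≤ δ := hδ.trans' (by positivity)
  have hδ1 : 1 ≤ 2 * r.den * δ := (div_le_iff₀' (by positivity)).1 hδ
  have hdenK : (r.den : ℝ) ≤ 2 * K := by exact_mod_cast hr.den_le
  have hsub : nearMultiples x δ K ⊆ nearMultiples r (2 * δ) K := by
    intro k hk
    obtain ⟨hkK, hkδ⟩ := mem_nearMultiples.1 hk
    refine mem_nearMultiples.2 ⟨hkK, ?_⟩
    calc distInt (k * r) ≤ |k * (r : ℝ) - round (k * x)| := distInt_le _ _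
      _ ≤ |k * r - k * x| + |k * x - round (k * x)| := abs_sub_le _ _ _
      _ ≤ δ + δ := by
        rw [abs_sub_comm]
        exact add_le_add ((hr.abs_mul_sub_mul_le hkK.2).trans hδ) hkδ
      _ = 2 * δ := by ring
  calc (#(nearMultiples x δ K) : ℝ)
      ≤ #(nearMultiples r (2 * δ) K) := Nat.cast_le.2 (card_le_card hsub)
    _ ≤ (K / r.den + 1) * (2 * r.den * (2 * δ) + 1) :=
      card_nearMultiples_ratCast_le r K (by positivity)
    _ ≤ (K / r.den + 1) * (6 * r.den * δ) := by gcongr; linarith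
    _ = 6 * δ * (K + r.den) := by field_simp
    _ ≤ 6 * δ * (K + 2 * K) := by gcongr
    _ = 18 * K * δ := by ring

theorem mul_eq_or_card_nearMultiples_le (hr : IsDirichletApprox x (2 * K) r) :
    (∀ k : ℕ, k ≤ K → ∀ z : ℤ, |k * x - z| ≤ δ → k * r = z) ∨
      (#(nearMultiples x δ K) : ℝ) ≤ 18 * K * δ := by
  refine or_iff_not_imp_left.2 fun h => hr.card_nearMultiples_le ?_
  push Not at h
  obtain ⟨k, hk, z, hz, hne⟩ := h
  have hden : (0 : ℝ) < r.den := Nat.cast_pos.2 r.pos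
  have hfar : 1 / r.den ≤ |(k : ℝ) * r - z| :=
    (div_le_iff₀' hden).2 (by exact_mod_cast one_le_den_mul_abs_sub (k := k) hne)
  have htri : |(k : ℝ) * r - z| ≤ 1 / (2 * r.den) + δ :=
    (abs_sub_le _ (k * x) _).trans <| add_le_add
      (by rw [abs_sub_comm]; exact hr.abs_mul_sub_mul_le hk) hz
  have hhalf : (1 : ℝ) / r.den = 1 / (2 * r.den) + 1 / (2 * r.den) := by field_simp; norm_num
  linarith

theorem card_nearMultiples_le_or (hr : IsDirichletApprox x (2 * K) r) (hδ : 0 ≤ δ) :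
    (#(nearMultiples x δ K) : ℝ) ≤ 18 * K * δ ∨
      #(nearMultiples x δ K) * r.den ≤ K ∧ #(nearMultiples x δ K) * (r.den * |x - r|) ≤ δ := by
  rcases hr.mul_eq_or_card_nearMultiples_le (δ := δ) with hexact | hfew
  swap
  · exact .inl hfew
  right
  rcases (nearMultiples x δ K).eq_empty_or_nonempty with hempty | hne
  · simp [hempty, hδ]
  set m := (nearMultiples x δ K).max' hne
  obtain ⟨⟨-, hmK⟩, hmδ⟩ := mem_nearMultiples.1 (max'_mem _ hne)
  have hround : ∀ k ∈ nearMultiples x δ K, k * r = round (k * x) := fun k hk =>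
    hexact k (mem_nearMultiples.1 hk).1.2 _ (mem_nearMultiples.1 hk).2
  have hsub : nearMultiples x δ K ⊆ {k ∈ Ioc 0 m | r.den ∣ k} := fun k hk =>
    mem_filter.2 ⟨mem_Ioc.2 ⟨(mem_nearMultiples.1 hk).1.1, le_max' _ _ hk⟩,
      Int.natCast_dvd_natCast.1 (den_dvd_of_mul_eq_intCast (by exact_mod_cast hround k hk))⟩
  have hcard : #(nearMultiples x δ K) * r.den ≤ m := by
    refine (Nat.le_div_iff_mul_le r.pos).1 ?_
    simpa only [Nat.Ioc_filter_dvd_card_eq_div] using card_le_card hsub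
  refine ⟨hcard.trans hmK, ?_⟩
  calc (#(nearMultiples x δ K) : ℝ) * (r.den * |x - r|)
      = ((#(nearMultiples x δ K) * r.den : ℕ) : ℝ) * |x - r| := by push_cast; ring
    _ ≤ m * |x - r| := by gcongr
    _ = |m * x - round (m * x)| := by
      have hm : (m : ℝ) * r = round (m * x) := by exact_mod_cast hround m (max'_mem _ hne)
      rw [← hm, ← mul_sub, abs_mul, Nat.abs_cast]
    _ ≤ δ := hmδ

end IsDirichletApprox

/-! ### Weyl differencing -/

/-- `τ` bounds the divisor function on `[0, X]`. -/
def DivisorBound (X τ : ℝ) : Prop :=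
  ∀ n : ℕ, (n : ℝ) ≤ X → (#n.divisors : ℝ) ≤ τ

theorem DivisorBound.mono {X Y τ : ℝ} (h : DivisorBound X τ) (hYX : Y ≤ X) : DivisorBound Y τ :=
  fun n hn => h n (hn.trans hYX)

theorem DivisorBound.nonneg {X τ : ℝ} (h : DivisorBound X τ) (hX : 0 ≤ X) : 0 ≤ τ := by
  simpa using h 0 (by simpa using hX)

theorem sum_sum_mul_le {A B : ℕ} {F : ℕ → ℝ} (hF : ∀ k, 0 ≤ F k) {τ : ℝ}
    (hτ : DivisorBound (2 * A * B : ℕ) τ) :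
    ∑ l ∈ Icc 1 A, ∑ h ∈ Icc 1 B, F (2 * l * h) ≤ τ * ∑ k ∈ Icc 1 (2 * A * B), F k := by
  rw [← sum_product']
  refine sum_comp_le_mul_sum (f := fun p : ℕ × ℕ => 2 * p.1 * p.2) (fun p hp => ?_)
    (fun k _ => hF k) fun k hk => (Nat.cast_le.2 ?_).trans (hτ k ?_)
  · obtain ⟨⟨hl, hlA⟩, hh, hhB⟩ := by simpa only [mem_product, mem_Icc] using hp
    exact mem_Icc.2 ⟨Nat.mul_pos (by omega) hh, by gcongr⟩
  · obtain ⟨hk1, -⟩ := mem_Icc.1 hk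
    refine card_le_card_of_injOn Prod.fst (fun p hp => ?_) fun p hp p' hp' hfst => ?_
    · obtain ⟨-, hpk⟩ := mem_filter.1 hp
      exact Nat.mem_divisors.2 ⟨⟨2 * p.2, by rw [← hpk]; ring⟩, by omega⟩
    · obtain ⟨-, hpk⟩ := mem_filter.1 hp
      obtain ⟨-, hpk'⟩ := mem_filter.1 hp'
      refine Prod.ext hfst (Nat.eq_of_mul_eq_mul_left (Nat.pos_of_ne_zero ?_)
        (show 2 * p.1 * p.2 = 2 * p.1 * p'.2 by rw [hpk, hfst, hpk']))
      intro hzero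
      rw [hzero] at hpk
      omega
  · exact Nat.cast_le.2 (mem_Icc.1 hk).2

theorem e_eq_fourierChar (x : ℝ) : e x = Real.fourierChar x := by
  rw [e, Real.fourierChar_apply]
  push_cast
  ring_nf

theorem norm_e (x : ℝ) : ‖e x‖ = 1 := by rw [e_eq_fourierChar, Circle.norm_coe]

theorem e_add (x y : ℝ) : e (x + y) = e x * e y := by
  simp only [e_eq_fourierChar, AddChar.map_add_eq_mul, Circle.coe_mul]

theorem e_neg (x : ℝ) : e (-x) = starRingEnd ℂ (e x) := by
  simp only [e_eq_fourierChar, AddChar.map_neg_eq_inv, Circle.coe_inv_eq_conj]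

theorem e_nsmul (n : ℕ) (x : ℝ) : e (n * x) = e x ^ n := by
  rw [← nsmul_eq_mul, e_eq_fourierChar, AddChar.map_nsmul_eq_pow, Circle.coe_pow, e_eq_fourierChar]

theorem e_sub_intCast (x : ℝ) (n : ℤ) : e (x - n) = e x := by
  have hn : e (-n) = 1 := Complex.exp_eq_one_iff.2 ⟨-n, by push_cast; ring⟩
  rw [sub_eq_add_neg, e_add, hn, mul_one]

theorem four_mul_distInt_le_norm_e_sub_one (x : ℝ) : 4 * distInt x ≤ ‖e x - 1‖ := by
  set y := x - round x
  have hexp : e y = Complex.exp (Complex.I * ((2 * Real.pi * y : ℝ) : ℂ)) := by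
    rw [e]
    push_cast
    ring_nf
  have hy : |Real.pi * y| ≤ Real.pi / 2 := by
    rw [abs_mul, abs_of_pos Real.pi_pos]
    nlinarith [Real.pi_pos, abs_sub_round x]
  calc 4 * distInt x = 2 * (2 / Real.pi * |Real.pi * y|) := by
        change 4 * |y| = _
        rw [abs_mul, abs_of_pos Real.pi_pos]
        field_simp
        ring
    _ ≤ 2 * |Real.sin (Real.pi * y)| := by gcongr; exact Real.mul_abs_le_abs_sin hy
    _ = ‖e y - 1‖ := by
      rw [hexp, Complex.norm_exp_I_mul_ofReal_sub_one, norm_mul, Real.norm_eq_abs,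
        Real.norm_eq_abs, abs_two, show 2 * Real.pi * y / 2 = Real.pi * y by ring]
    _ = ‖e x - 1‖ := by rw [e_sub_intCast]

theorem norm_sum_e_linear_le (x c : ℝ) (n : ℕ) :
    ‖∑ i ∈ range n, e (i * x + c)‖ * (2 * distInt x) ≤ 1 := by
  have hgeom : ‖∑ i ∈ range n, e x ^ i‖ * ‖e x - 1‖ ≤ 2 :=
    calc _ = ‖e x ^ n - 1‖ := by rw [← norm_mul, geom_sum_mul]
      _ ≤ ‖e x ^ n‖ + ‖(1 : ℂ)‖ := norm_sub_le _ _
      _ = 2 := by rw [norm_pow, norm_e]; norm_num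
  have hsum : ‖∑ i ∈ range n, e (i * x + c)‖ = ‖∑ i ∈ range n, e x ^ i‖ := by
    simp only [e_add, e_nsmul, ← sum_mul, norm_mul, norm_e, mul_one]
  have hchord := mul_le_mul_of_nonneg_left (four_mul_distInt_le_norm_e_sub_one x)
    (norm_nonneg (∑ i ∈ range n, e x ^ i))
  rw [hsum]
  linarith

theorem norm_sq_sum_le_re (z : ℕ → ℂ) (M : ℕ) :
    ‖∑ i ∈ range M, z i‖ ^ 2 ≤
      2 * (∑ m ∈ range M, ∑ h ∈ range (m + 1), z m * starRingEnd ℂ (z h)).re := by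
  induction M with
  | zero => simp
  | succ M ih =>
    set S := ∑ i ∈ range M, z i with hS
    have hlast : ∑ h ∈ range (M + 1), z M * starRingEnd ℂ (z h)
        = z M * starRingEnd ℂ (S + z M) := by
      rw [← mul_sum, ← map_sum, sum_range_succ]
    have hexpand : ‖S + z M‖ ^ 2
        = ‖S‖ ^ 2 + 2 * (z M * starRingEnd ℂ (S + z M)).re - ‖z M‖ ^ 2 := by
      simp only [← Complex.normSq_eq_norm_sq, Complex.normSq_apply, Complex.add_re,
        Complex.add_im, Complex.mul_re, Complex.conj_re, Complex.conj_im]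
      ring
    rw [sum_range_succ, sum_range_succ _ M, Complex.add_re, mul_add, hlast, ← hS, hexpand]
    linarith [sq_nonneg ‖z M‖]

theorem norm_sq_sum_le_sum_norm_correlation (z : ℕ → ℂ) (M : ℕ) :
    ‖∑ i ∈ range M, z i‖ ^ 2 ≤
      2 * ∑ h ∈ range M, ‖∑ i ∈ range (M - h), z (i + h) * starRingEnd ℂ (z i)‖ := by
  have hflip : ∑ m ∈ range M, ∑ h ∈ range (m + 1), z m * starRingEnd ℂ (z h)
      = ∑ h ∈ range M, ∑ i ∈ range (M - h), z (i + h) * starRingEnd ℂ (z i) := by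
    rw [← sum_range_diag_flip M fun h i => z (i + h) * starRingEnd ℂ (z i)]
    refine sum_congr rfl fun m _ => ?_
    rw [← sum_range_reflect]
    refine sum_congr rfl fun h hh => ?_
    have hhm : h ≤ m := Nat.lt_succ_iff.1 (mem_range.1 hh)
    rw [Nat.add_sub_cancel, Nat.sub_add_cancel hhm]
  refine (norm_sq_sum_le_re z M).trans ?_
  rw [hflip]
  gcongr
  exact (Complex.re_le_norm _).trans (norm_sum_le _ _)

/-- A majorant of `min (2 ^ I) (1 / (2‖x‖))` built from the level sets of `‖x‖`, so that its sums
reduce to counting. -/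
noncomputable def dyadicMajorant (I : ℕ) (x : ℝ) : ℝ :=
  ∑ i ∈ range (I + 1), if distInt x ≤ (1 / 2) ^ i then 2 ^ i else 0

theorem dyadicMajorant_nonneg (I : ℕ) (x : ℝ) : 0 ≤ dyadicMajorant I x :=
  sum_nonneg fun i _ => by split_ifs <;> positivity

theorem le_dyadicMajorant {I : ℕ} {x B : ℝ} (hB : B ≤ 2 ^ I) (hBx : B * (2 * distInt x) ≤ 1) :
    B ≤ dyadicMajorant I x := by
  induction I with
  | zero =>
    have : distInt x ≤ 1 := (distInt_le_half x).trans (by norm_num)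
    simpa [dyadicMajorant, this] using hB
  | succ I ih =>
    rw [dyadicMajorant, sum_range_succ]
    split_ifs with hx
    · exact hB.trans (le_add_of_nonneg_left (dyadicMajorant_nonneg I x))
    · rw [add_zero]
      refine ih (le_of_not_gt fun hlt => hBx.not_gt ?_)
      calc (1 : ℝ) = 2 ^ I * (2 * (1 / 2) ^ (I + 1)) := by
            rw [pow_succ, one_div, inv_pow]
            field_simp
        _ < B * (2 * distInt x) := by
          have := (show (0 : ℝ) < 2 ^ I by positivity).trans hlt
          gcongr
          exact not_le.1 hx

/-- For the approximation `r = u / t` to `x`, the size `max t (D |t x - u|)` by which it divides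
the number of solutions of `‖kx‖ ≤ δ`. -/
noncomputable def approxHeight (D x : ℝ) (r : ℚ) : ℝ := r.den * max 1 (D * |x - r|)

theorem den_le_approxHeight (D x : ℝ) (r : ℚ) : (r.den : ℝ) ≤ approxHeight D x r :=
  le_mul_of_one_le_right (Nat.cast_nonneg _) (le_max_left _ _)

theorem one_le_approxHeight (D x : ℝ) (r : ℚ) : 1 ≤ approxHeight D x r :=
  (Nat.one_le_cast.2 r.pos).trans (den_le_approxHeight D x r)

theorem den_mul_abs_sub_le_approxHeight {D : ℝ} (hD : 0 < D) (x : ℝ) (r : ℚ) :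
    r.den * |x - r| ≤ approxHeight D x r / D := by
  rw [le_div_iff₀ hD, mul_assoc, mul_comm _ D]
  exact mul_le_mul_of_nonneg_left (le_max_right _ _) (Nat.cast_nonneg _)

theorem IsDirichletApprox.sum_dyadicMajorant_le {x D : ℝ} {K I : ℕ} {r : ℚ}
    (hr : IsDirichletApprox x (2 * K) r) (hD : 2 ^ I * (K : ℝ) ≤ 4 * D) :
    ∑ k ∈ Icc 1 K, dyadicMajorant I (k * x)
      ≤ (I + 1) * (18 * K + 4 * D / approxHeight D x r) := by
  have hK : (0 : ℝ) < K := Nat.cast_pos.2 hr.pos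
  have hD0 : 0 < D := by
    have : (0 : ℝ) < 2 ^ I * K := by positivity
    linarith
  have hheight := one_le_approxHeight D x r
  have hlevel : ∀ i ∈ range (I + 1),
      (#(nearMultiples x ((1 / 2) ^ i) K) : ℝ) * 2 ^ i
        ≤ 18 * K + 4 * D / approxHeight D x r := by
    intro i hi
    have hiI : (2 : ℝ) ^ i ≤ 2 ^ I :=
      pow_le_pow_right₀ one_le_two (Nat.lt_succ_iff.1 (mem_range.1 hi))
    have hcancel : (1 / 2 : ℝ) ^ i * 2 ^ i = 1 := by rw [← mul_pow]; norm_num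
    set c : ℝ := (#(nearMultiples x ((1 / 2) ^ i) K) : ℝ)
    rcases hr.card_nearMultiples_le_or (δ := (1 / 2) ^ i) (by positivity) with hc | ⟨hcK, hcδ⟩
    · calc c * 2 ^ i ≤ 18 * K * (1 / 2) ^ i * 2 ^ i := by gcongr
        _ = 18 * K := by rw [mul_assoc, hcancel, mul_one]
        _ ≤ _ := le_add_of_nonneg_right (by positivity)
    · refine le_add_of_nonneg_of_le (by positivity) ((le_div_iff₀ (by linarith)).2 ?_)
      have hcK' : c * r.den ≤ K := by
        simp only [c]
        exact_mod_cast hcK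
      rw [approxHeight, mul_max_of_nonneg _ _ (Nat.cast_nonneg _),
        mul_max_of_nonneg _ _ (by positivity)]
      refine max_le ?_ ?_
      · calc c * 2 ^ i * (r.den * 1) = 2 ^ i * (c * r.den) := by ring
          _ ≤ 2 ^ I * K := by gcongr
          _ ≤ 4 * D := hD
      · calc c * 2 ^ i * (r.den * (D * |x - r|)) = c * (r.den * |x - r|) * (2 ^ i * D) := by ring
          _ ≤ (1 / 2) ^ i * (2 ^ i * D) := by gcongr
          _ = D := by rw [← mul_assoc, hcancel, one_mul]
          _ ≤ 4 * D := by linarith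
  calc ∑ k ∈ Icc 1 K, dyadicMajorant I (k * x)
      = ∑ i ∈ range (I + 1), #(nearMultiples x ((1 / 2) ^ i) K) * (2 : ℝ) ^ i := by
        simp only [dyadicMajorant]
        rw [sum_comm]
        exact sum_congr rfl fun i _ => by rw [← sum_filter, sum_const, nsmul_eq_mul]; rfl
    _ ≤ ∑ i ∈ range (I + 1), (18 * K + 4 * D / approxHeight D x r) := sum_le_sum hlevel
    _ = (I + 1) * (18 * K + 4 * D / approxHeight D x r) := by
      rw [sum_const, card_range, nsmul_eq_mul, Nat.cast_succ]

theorem norm_sq_sum_e_quadratic_le (α β γ : ℝ) {M I : ℕ} (hM : (M : ℝ) ≤ 2 ^ I) :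
    ‖∑ i ∈ range M, e (α * i ^ 2 + β * i + γ)‖ ^ 2
      ≤ 2 * (M + ∑ h ∈ Icc 1 M, dyadicMajorant I (2 * h * α)) := by
  refine (norm_sq_sum_le_sum_norm_correlation _ M).trans ?_
  have hcorr : ∀ h i : ℕ, e (α * (i + h : ℕ) ^ 2 + β * (i + h : ℕ) + γ) *
      starRingEnd ℂ (e (α * i ^ 2 + β * i + γ))
        = e (i * (2 * h * α) + (α * h ^ 2 + β * h)) := by
    intro h i
    rw [← e_neg, ← e_add]
    push_cast
    ring_nf
  simp only [hcorr]
  have htriv : ∀ h : ℕ,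
      ‖∑ i ∈ range (M - h), e (i * (2 * h * α) + (α * h ^ 2 + β * h))‖ ≤ M := fun h =>
    calc _ ≤ ∑ i ∈ range (M - h), ‖e (i * (2 * h * α) + (α * h ^ 2 + β * h))‖ := norm_sum_le _ _
      _ = (M - h : ℕ) := by simp only [norm_e, sum_const, card_range, nsmul_eq_mul, mul_one]
      _ ≤ M := Nat.cast_le.2 (Nat.sub_le M h)
  rcases M.eq_zero_or_pos with rfl | hM0
  · simp
  rw [range_eq_Ico, sum_eq_sum_Ico_succ_bot hM0]
  gcongr
  · exact htriv 0
  · calc _ ≤ ∑ h ∈ Ico 1 M, dyadicMajorant I (2 * h * α) := sum_le_sum fun h _ =>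
          le_dyadicMajorant ((htriv h).trans hM) (norm_sum_e_linear_le _ _ _)
      _ ≤ ∑ h ∈ Icc 1 M, dyadicMajorant I (2 * h * α) :=
        sum_le_sum_of_subset_of_nonneg Ico_subset_Icc_self fun _ _ _ => dyadicMajorant_nonneg _ _

theorem exists_eq_Ico_of_ordConnected (s : Finset ℕ) (hs : (s : Set ℕ).OrdConnected) :
    ∃ n M : ℕ, s = Ico n (n + M) := by
  rcases s.eq_empty_or_nonempty with rfl | hne
  · exact ⟨0, 0, by simp⟩
  · refine ⟨s.min' hne, s.max' hne + 1 - s.min' hne, ?_⟩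
    have hle := s.min'_le_max' hne
    ext x
    rw [mem_Ico]
    refine ⟨fun hx => ?_, fun hx => hs.out (s.min'_mem hne) (s.max'_mem hne) ⟨hx.1, by omega⟩⟩
    have hmin := s.min'_le x hx
    have hmax := s.le_max' x hx
    omega

section MeanSquare

variable {N H : ℝ} {S : ℕ → Set ℝ} {m : ℕ}

theorem exists_integersIn_eq_Ico (hN : 0 ≤ N) (hS : IsSubintervalFamily N S) (hm : 0 < m)
    (hH : N / m ≤ H) : ∃ n M : ℕ, M ≤ ⌊H⌋₊ ∧ integersIn N S m = Ico n (n + M) := by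
  have hord : (integersIn N S m : Set ℕ).OrdConnected := by
    refine ⟨fun x hx y hy z hz => ?_⟩
    rw [mem_coe, mem_integersIn hN hS hm] at hx hy ⊢
    exact (hS m hm).1.out hx hy ⟨Nat.cast_le.2 hz.1, Nat.cast_le.2 hz.2⟩
  obtain ⟨n, M, hnM⟩ := exists_eq_Ico_of_ordConnected _ hord
  refine ⟨n, M, ?_, hnM⟩
  have hcard : #(integersIn N S m) ≤ ⌊N / m⌋₊ := by
    classical exact (card_filter_le _ _).trans_eq (Nat.card_Icc 1 _)
  rw [hnM, Nat.card_Ico, Nat.add_sub_cancel_left] at hcard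
  exact hcard.trans (Nat.floor_le_floor hH)

theorem norm_sq_sum_e_g_le (hN : 0 ≤ N) (hS : IsSubintervalFamily N S) (hm : 0 < m)
    (hH : N / m ≤ H) {I : ℕ} (hI : H ≤ 2 ^ I) (a : ℤ) (q : ℕ) (β γ : ℝ) (l : ℕ) :
    ‖∑ n ∈ integersIn N S m, e (l * g a q β γ (m * n))‖ ^ 2
      ≤ 2 * (H + ∑ h ∈ Icc 1 ⌊H⌋₊,
          dyadicMajorant I ((2 * l * h : ℕ) * ((m : ℝ) ^ 2 * (a / q)))) := by
  obtain ⟨n₀, M, hMH, hJ⟩ := exists_integersIn_eq_Ico hN hS hm hH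
  have hMH' : (M : ℝ) ≤ H :=
    (Nat.cast_le.2 hMH).trans (Nat.floor_le (hH.trans' (by positivity)))
  have hphase : ∀ i : ℕ, l * g a q β γ (m * ((n₀ + i : ℕ) : ℝ))
      = l * ((m : ℝ) ^ 2 * (a / q)) * i ^ 2
        + l * (2 * (a / q) * m ^ 2 * n₀ + β * m) * i + l * g a q β γ (m * n₀) := by
    intro i
    rw [g, g]
    push_cast
    ring
  rw [hJ, sum_Ico_eq_sum_range, Nat.add_sub_cancel_left]
  simp only [hphase]
  refine (norm_sq_sum_e_quadratic_le _ _ _ (hMH'.trans hI)).trans ?_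
  have hcast : ∀ h : ℕ, 2 * h * (l * ((m : ℝ) ^ 2 * (a / q)))
      = (2 * l * h : ℕ) * ((m : ℝ) ^ 2 * (a / q)) := by
    intro h
    push_cast
    ring
  simp only [hcast]
  gcongr
  · intros
    exact dyadicMajorant_nonneg _ _

theorem sum_norm_sq_le {L τ : ℝ} (hN : 0 ≤ N) (hS : IsSubintervalFamily N S) (hm : 0 < m)
    (hH : N / m ≤ H) (hH0 : 0 ≤ H) (hL : 0 ≤ L) {I : ℕ} (hI : H ≤ 2 ^ I) (hI2 : 2 ^ I ≤ 2 * H)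
    (a : ℤ) (q : ℕ) (β γ : ℝ) {r : ℚ}
    (hr : IsDirichletApprox ((m : ℝ) ^ 2 * (a / q)) (2 * (2 * ⌊L⌋₊ * ⌊H⌋₊)) r)
    (hτ : DivisorBound (2 * ⌊L⌋₊ * ⌊H⌋₊ : ℕ) τ) :
    ∑ l ∈ Icc 1 ⌊L⌋₊, ‖∑ n ∈ integersIn N S m, e (l * g a q β γ (m * n))‖ ^ 2
      ≤ 2 * (L * H + τ * ((I + 1) * (36 * (L * H) + 4 * (L * H ^ 2) /
          approxHeight (L * H ^ 2) ((m : ℝ) ^ 2 * (a / q)) r))) := by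
  set x : ℝ := (m : ℝ) ^ 2 * (a / q)
  set K := 2 * ⌊L⌋₊ * ⌊H⌋₊
  have hLfloor : (⌊L⌋₊ : ℝ) ≤ L := Nat.floor_le hL
  have hK : (K : ℝ) ≤ 2 * (L * H) :=
    calc (K : ℝ) = 2 * (⌊L⌋₊ * ⌊H⌋₊) := by push_cast [K]; ring
      _ ≤ 2 * (L * H) := by gcongr; exact Nat.floor_le hH0
  have hD : 2 ^ I * (K : ℝ) ≤ 4 * (L * H ^ 2) :=
    calc 2 ^ I * (K : ℝ) ≤ 2 * H * (2 * (L * H)) := by gcongr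
      _ = 4 * (L * H ^ 2) := by ring
  have hτ0 : 0 ≤ τ := hτ.nonneg (by positivity)
  calc ∑ l ∈ Icc 1 ⌊L⌋₊, ‖∑ n ∈ integersIn N S m, e (l * g a q β γ (m * n))‖ ^ 2
      ≤ ∑ l ∈ Icc 1 ⌊L⌋₊, 2 * (H + ∑ h ∈ Icc 1 ⌊H⌋₊, dyadicMajorant I ((2 * l * h : ℕ) * x)) :=
        sum_le_sum fun l _ => norm_sq_sum_e_g_le hN hS hm hH hI a q β γ l
    _ = 2 * (⌊L⌋₊ * H + ∑ l ∈ Icc 1 ⌊L⌋₊, ∑ h ∈ Icc 1 ⌊H⌋₊,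
          dyadicMajorant I ((2 * l * h : ℕ) * x)) := by
      rw [← mul_sum, sum_add_distrib, sum_const, Nat.card_Icc, Nat.add_sub_cancel, nsmul_eq_mul]
    _ ≤ 2 * (L * H + τ * ∑ k ∈ Icc 1 K, dyadicMajorant I (k * x)) := by
      gcongr
      exact sum_sum_mul_le (F := fun k => dyadicMajorant I (k * x))
        (fun _ => dyadicMajorant_nonneg _ _) hτ
    _ ≤ 2 * (L * H + τ * ((I + 1) *
          (18 * K + 4 * (L * H ^ 2) / approxHeight (L * H ^ 2) x r))) := by
      gcongr
      exact hr.sum_dyadicMajorant_le hD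
    _ ≤ _ := by
      gcongr 2 * (_ + τ * (_ * (?_ + _)))
      linarith

end MeanSquare

/-! ### Slices with fixed `w` -/

theorem exists_le_sq_dvd_of_dvd_sq {d : ℕ} (hd : 0 < d) :
    ∃ f : ℕ, 0 < f ∧ d ≤ f ^ 2 ∧ ∀ v : ℕ, d ∣ v ^ 2 → f ∣ v := by
  obtain ⟨s, b, hs, hb, rfl, hsq⟩ := Nat.sq_mul_squarefree_of_pos hd
  refine ⟨b * s, by positivity, ?_, fun v h => ?_⟩
  · rw [mul_pow]
    exact Nat.mul_le_mul_left _ (Nat.le_self_pow two_ne_zero s)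
  · obtain ⟨c, rfl⟩ : b ∣ v := (Nat.pow_dvd_pow_iff two_ne_zero).1 ((Dvd.intro _ rfl).trans h)
    rw [mul_pow] at h
    have hsc : s ∣ c ^ 2 := Nat.dvd_of_mul_dvd_mul_left (pow_pos hb 2) h
    exact Nat.mul_dvd_mul_left b ((hsq.dvd_pow_iff_dvd two_ne_zero).1 hsc)

theorem card_le_div_sqrt_of_dvd_sq {d : ℕ} (hd : 0 < d) {V : ℝ} (hV : 0 ≤ V) {s : Finset ℕ}
    (hs : ∀ v ∈ s, 0 < v ∧ (v : ℝ) ≤ V ∧ d ∣ v ^ 2) : (#s : ℝ) ≤ V / √d := by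
  obtain ⟨f, _, hdf, hdvd⟩ := exists_le_sq_dvd_of_dvd_sq hd
  have hsub : s ⊆ {v ∈ Ioc 0 ⌊V⌋₊ | f ∣ v} := fun v hv => by
    obtain ⟨hv0, hvV, hdv⟩ := hs v hv
    exact mem_filter.2 ⟨mem_Ioc.2 ⟨hv0, Nat.le_floor hvV⟩, hdvd v hdv⟩
  have : (0 : ℝ) < d := Nat.cast_pos.2 hd
  calc (#s : ℝ) ≤ (⌊V⌋₊ / f : ℕ) := by
        exact_mod_cast (card_le_card hsub).trans_eq (Nat.Ioc_filter_dvd_card_eq_div _ _)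
    _ ≤ ⌊V⌋₊ / f := Nat.cast_div_le
    _ ≤ V / √d := by
      gcongr
      · exact Nat.floor_le hV
      · exact (Real.sqrt_le_left (Nat.cast_nonneg f)).2 (by exact_mod_cast hdf)

theorem abs_den_mul_sub_num (r : ℚ) (x : ℝ) : |r.den * x - r.num| = r.den * |x - r| := by
  have hnum : (r.den : ℝ) * (r : ℝ) = r.num := by exact_mod_cast Rat.den_mul_eq_num r
  rw [← hnum, ← mul_sub, abs_mul, Nat.abs_cast]

theorem den_dvd_den_of_eq_natCast_mul {r r₀ : ℚ} {n : ℕ} (h : r = n * r₀) : r.den ∣ r₀.den := by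
  simpa only [h, Rat.den_natCast, one_mul] using Rat.mul_den_dvd (n : ℚ) r₀

theorem dvd_of_den_eq_den_mul {r r₀ : ℚ} {n c : ℕ} (h : r = n * r₀) (hc : r₀.den = r.den * c) :
    c ∣ n := by
  have hmul : ((r.den * n : ℤ) : ℚ) * r₀ = r.num := by
    rw [Int.cast_mul, Int.cast_natCast, Int.cast_natCast, mul_assoc, ← h, Rat.den_mul_eq_num]
  have hdvd : r₀.den ∣ r.den * n := by exact_mod_cast den_dvd_of_mul_eq_intCast hmul
  exact Nat.dvd_of_mul_dvd_mul_left r.pos (hc ▸ hdvd)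

theorem distInt_den_mul_le {r r₀ : ℚ} {n c : ℕ} (hn : 0 < n) (h : r = n * r₀)
    (hc : r₀.den = r.den * c) (β : ℝ) :
    distInt (r₀.den * β) ≤ c * (r.den * |n * β - r|) / n := by
  have : (0 : ℝ) < n := Nat.cast_pos.2 hn
  refine (distInt_le _ r₀.num).trans (le_of_eq ?_)
  have hr : (n : ℝ) * β - r = n * (β - r₀) := by rw [h, Rat.cast_mul, Rat.cast_natCast, mul_sub]
  rw [abs_den_mul_sub_num, hr, abs_mul, Nat.abs_cast, hc, Nat.cast_mul]
  field_simp

section Slice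

variable {β V Y Z τ : ℝ} {K : ℕ} {G : Finset ℕ} {r : ℕ → ℚ}

theorem card_le_mul_card_nearMultiples (hG : ∀ v ∈ G, 0 < v) (hK : ∀ v ∈ G, (r v).den * v ^ 2 ≤ K)
    (hZ : ∀ v ∈ G, (r v).den * |(v : ℝ) ^ 2 * β - r v| ≤ Z) (hτ : DivisorBound K τ) :
    (#G : ℝ) ≤ τ * #(nearMultiples β Z K) := by
  refine card_le_mul_card (f := fun v => (r v).den * v ^ 2) (fun v hv => ?_) fun k hk => ?_
  · refine mem_nearMultiples.2
      ⟨⟨Nat.mul_pos (r v).pos (pow_pos (hG v hv) 2), hK v hv⟩, ?_⟩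
    refine (distInt_le _ (r v).num).trans ((le_of_eq ?_).trans (hZ v hv))
    rw [Nat.cast_mul, Nat.cast_pow, mul_assoc, abs_den_mul_sub_num]
  · obtain ⟨⟨hk1, hkK⟩, -⟩ := mem_nearMultiples.1 hk
    refine (Nat.cast_le.2 (card_le_card fun v hv => ?_)).trans (hτ k (Nat.cast_le.2 hkK))
    rw [Nat.mem_divisors, ← (mem_filter.1 hv).2]
    exact ⟨Dvd.dvd.mul_left (Dvd.intro_left v (sq v).symm) _, by
      rw [(mem_filter.1 hv).2]; omega⟩

/-- If every `r v` is the corresponding multiple of one fraction `r₀`, then the most popular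
denominator `d` of the `r v` leaves a cofactor `r₀.den / d` dividing all the `v ^ 2`. -/
theorem exists_card_le_of_forall_eq_sq_mul (hV : 0 < V) (hne : G.Nonempty)
    (hG : ∀ v ∈ G, V < v ∧ (v : ℝ) ≤ 2 * V) (hY : ∀ v ∈ G, ((r v).den : ℝ) ≤ Y)
    (hZ : ∀ v ∈ G, (r v).den * |(v : ℝ) ^ 2 * β - r v| ≤ Z) {r₀ : ℚ}
    (hr : ∀ v ∈ G, r v = (v : ℚ) ^ 2 * r₀) (hτ : (#r₀.den.divisors : ℝ) ≤ τ) :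
    ∃ k c : ℕ, 0 < k ∧ 0 < c ∧ (k : ℝ) ≤ Y * c ∧ distInt (k * β) ≤ Z * c / V ^ 2 ∧
      (#G : ℝ) ≤ τ * (2 * V / √c) := by
  have hr' : ∀ v ∈ G, r v = (v ^ 2 : ℕ) * r₀ := fun v hv => by rw [hr v hv, Nat.cast_pow]
  have hdivisors : (0 : ℝ) < #r₀.den.divisors := by
    exact_mod_cast card_pos.2 ⟨1, Nat.one_mem_divisors.2 r₀.den_ne_zero⟩
  obtain ⟨d, hd, hcard⟩ := exists_le_card_fiber_of_nsmul_le_card_of_maps_to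
    (fun v hv => Nat.mem_divisors.2 ⟨den_dvd_den_of_eq_natCast_mul (hr' v hv), r₀.den_ne_zero⟩)
    ⟨1, Nat.one_mem_divisors.2 r₀.den_ne_zero⟩ (b := (#G : ℝ) / #r₀.den.divisors)
    (by rw [nsmul_eq_mul, mul_div_cancel₀ _ hdivisors.ne'])
  obtain ⟨c, hc⟩ := Nat.dvd_of_mem_divisors hd
  have hc0 : 0 < c := Nat.pos_of_mul_pos_left (hc ▸ r₀.pos)
  have hF : ∀ v ∈ {v ∈ G | (r v).den = d}, 0 < v ∧ v ∈ G ∧ r₀.den = (r v).den * c := by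
    intro v hv
    obtain ⟨hvG, rfl⟩ := mem_filter.1 hv
    exact ⟨Nat.cast_pos.1 (hV.trans (hG v hvG).1), hvG, hc⟩
  have hcardF : (#{v ∈ G | (r v).den = d} : ℝ) ≤ 2 * V / √c :=
    card_le_div_sqrt_of_dvd_sq hc0 (by positivity) fun v hv => by
      obtain ⟨hv0, hvG, hden⟩ := hF v hv
      exact ⟨hv0, (hG v hvG).2, dvd_of_den_eq_den_mul (hr' v hvG) hden⟩
  obtain ⟨v, hv⟩ : {v ∈ G | (r v).den = d}.Nonempty := by
    rw [← card_pos, ← Nat.cast_pos (α := ℝ)]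
    exact hcard.trans_lt' (div_pos (Nat.cast_pos.2 hne.card_pos) hdivisors)
  obtain ⟨hv0, hvG, hden⟩ := hF v hv
  refine ⟨r₀.den, c, r₀.pos, hc0, ?_, ?_, ?_⟩
  · rw [hden, Nat.cast_mul]
    exact mul_le_mul_of_nonneg_right (hY v hvG) (Nat.cast_nonneg c)
  · refine (distInt_den_mul_le (pow_pos hv0 2) (hr' v hvG) hden β).trans ?_
    rw [Nat.cast_pow, mul_comm]
    have := (hG v hvG).1.le
    have := (mul_nonneg (Nat.cast_nonneg _) (abs_nonneg _)).trans (hZ v hvG)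
    gcongr
    exact hZ v hvG
  · rw [div_le_iff₀' hdivisors] at hcard
    exact hcard.trans (mul_le_mul hτ hcardF (Nat.cast_nonneg _) (hdivisors.le.trans hτ))

theorem card_slice_le (hV : 0 < V) (hne : G.Nonempty)
    (hG : ∀ v ∈ G, V < v ∧ (v : ℝ) ≤ 2 * V)
    (hY : ∀ v ∈ G, ((r v).den : ℝ) ≤ Y) (hK : ∀ v ∈ G, (r v).den * v ^ 2 ≤ K)
    (hZ : ∀ v ∈ G, (r v).den * |(v : ℝ) ^ 2 * β - r v| ≤ Z) (hτ : DivisorBound (2 * K) τ) :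
    (#G : ℝ) ≤ 18 * K * Z * τ ∨ ∃ k c : ℕ, 0 < k ∧ 0 < c ∧ (k : ℝ) ≤ Y * c ∧
      distInt (k * β) ≤ Z * c / V ^ 2 ∧ (#G : ℝ) ≤ τ * (2 * V / √c) := by
  have hG0 : ∀ v ∈ G, 0 < v := fun v hv => Nat.cast_pos.1 (hV.trans (hG v hv).1)
  obtain ⟨v₀, hv₀⟩ := hne
  have hK0 : 0 < K := (Nat.mul_pos (r v₀).pos (pow_pos (hG0 v₀ hv₀) 2)).trans_le (hK v₀ hv₀)
  obtain ⟨r₀, hr₀⟩ := exists_isDirichletApprox β (n := 2 * K) (by omega)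
  rcases hr₀.mul_eq_or_card_nearMultiples_le (δ := Z) with hexact | hfew
  · refine .inr (exists_card_le_of_forall_eq_sq_mul hV ⟨v₀, hv₀⟩ hG hY hZ (fun v hv => ?_)
      (hτ _ (by exact_mod_cast hr₀.den_le)))
    have hden : ((r v).den : ℚ) ≠ 0 := Nat.cast_ne_zero.2 (r v).den_nz
    have hmul : ((r v).den : ℚ) * ((v : ℚ) ^ 2 * r₀) = (r v).den * r v := by
      rw [Rat.den_mul_eq_num, ← mul_assoc]
      exact_mod_cast hexact _ (hK v hv) (r v).num (by
        rw [Nat.cast_mul, Nat.cast_pow, mul_assoc, abs_den_mul_sub_num]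
        exact hZ v hv)
    exact (mul_left_cancel₀ hden hmul).symm
  · refine .inl ((card_le_mul_card_nearMultiples hG0 hK hZ
      (hτ.mono (by linarith [K.cast_nonneg (α := ℝ)]))).trans ?_)
    rw [mul_comm]
    exact mul_le_mul_of_nonneg_right hfew (hτ.nonneg (by positivity))

end Slice

/-! ### Pairs `w < w'` with a common denominator -/

section Collisions

variable {B : Finset ℕ} {k : ℕ → ℕ}

/-- The unordered pairs of distinct elements of `B` on which `k` agrees, each listed with its
smaller element first. -/
def collisions (B : Finset ℕ) (k : ℕ → ℕ) : Finset (ℕ × ℕ) :=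
  {p ∈ B ×ˢ B | p.1 < p.2 ∧ k p.1 = k p.2}

theorem mem_collisions {p : ℕ × ℕ} :
    p ∈ collisions B k ↔ (p.1 ∈ B ∧ p.2 ∈ B) ∧ p.1 < p.2 ∧ k p.1 = k p.2 := by
  rw [collisions, mem_filter, mem_product]

theorem sum_card_fiber_sq {ι κ : Type*} [DecidableEq κ] (s : Finset ι) (f : ι → κ) {t : Finset κ}
    (hf : ∀ x ∈ s, f x ∈ t) :
    ∑ y ∈ t, #{x ∈ s | f x = y} ^ 2 = #{p ∈ s ×ˢ s | f p.1 = f p.2} := by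
  rw [card_eq_sum_card_fiberwise (f := fun p => f p.1) (t := t)
    fun p hp => hf _ (mem_product.1 (mem_filter.1 hp).1).1]
  refine sum_congr rfl fun y _ => ?_
  rw [sq, ← card_product]
  congr 1
  ext p
  simp only [mem_product, mem_filter]
  grind

theorem card_filter_eq_le_card_add_card_collisions :
    #{p ∈ B ×ˢ B | k p.1 = k p.2} ≤ #B + 2 * #(collisions B k) := by
  have hsub : {p ∈ B ×ˢ B | k p.1 = k p.2}
      ⊆ B.diag ∪ (collisions B k ∪ (collisions B k).image Prod.swap) := by
    rintro ⟨x, y⟩ hp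
    simp only [mem_union, mem_diag, mem_image, mem_collisions, Prod.exists, Prod.swap_prod_mk,
      mem_filter, mem_product, Prod.mk.injEq] at hp ⊢
    grind
  calc #{p ∈ B ×ˢ B | k p.1 = k p.2}
    _ ≤ #(B.diag ∪ (collisions B k ∪ (collisions B k).image Prod.swap)) := card_le_card hsub
    _ ≤ #(B.diag) + (#(collisions B k) + #((collisions B k).image Prod.swap)) :=
      (card_union_le _ _).trans (Nat.add_le_add_left (card_union_le _ _) _)
    _ ≤ #B + (#(collisions B k) + #(collisions B k)) := by
      rw [diag_card]
      exact Nat.add_le_add_left (Nat.add_le_add_left card_image_le _) _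
    _ = #B + 2 * #(collisions B k) := by rw [two_mul]

theorem card_sq_le_mul_card_collisions {Q : ℕ} (hB : ∀ w ∈ B, 1 ≤ k w ∧ k w ≤ Q) :
    #B ^ 2 ≤ Q * (#B + 2 * #(collisions B k)) := by
  have hmaps : ∀ w ∈ B, k w ∈ Icc 1 Q := fun w hw => mem_Icc.2 (hB w hw)
  calc #B ^ 2 = (∑ κ ∈ Icc 1 Q, #{w ∈ B | k w = κ}) ^ 2 := by
        rw [← card_eq_sum_card_fiberwise hmaps]
    _ ≤ #(Icc 1 Q) * ∑ κ ∈ Icc 1 Q, #{w ∈ B | k w = κ} ^ 2 := sq_sum_le_card_mul_sum_sq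
    _ = Q * #{p ∈ B ×ˢ B | k p.1 = k p.2} := by
      rw [Nat.card_Icc, Nat.add_sub_cancel, sum_card_fiber_sq B k hmaps]
    _ ≤ Q * (#B + 2 * #(collisions B k)) :=
      Nat.mul_le_mul_left _ card_filter_eq_le_card_add_card_collisions

/-- A collision `w < w'` with common value `κ` makes `κ (w' - w) (w' + w)` a near-multiple, and is
determined by the two divisors `w' - w` and `w' + w`. -/
theorem card_collisions_le {α Z τ : ℝ} {M : ℕ} (hk : ∀ w ∈ B, 0 < k w)
    (hM : ∀ w ∈ B, k w * w ^ 2 ≤ M) (hZ : ∀ w ∈ B, distInt (k w * ((w : ℝ) ^ 2 * α)) ≤ Z)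
    (hτ : DivisorBound M τ) :
    (#(collisions B k) : ℝ) ≤ τ ^ 2 * #(nearMultiples α (2 * Z) M) := by
  set f : ℕ × ℕ → ℕ := fun p => k p.1 * ((p.2 - p.1) * (p.2 + p.1))
  have hf : ∀ p ∈ collisions B k, f p + k p.1 * p.1 ^ 2 = k p.2 * p.2 ^ 2 := by
    intro p hp
    obtain ⟨-, hlt, hkeq⟩ := mem_collisions.1 hp
    rw [← hkeq, ← mul_add, mul_comm (p.2 - p.1), ← Nat.sq_sub_sq,
      Nat.sub_add_cancel (Nat.pow_le_pow_left hlt.le 2)]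
  refine card_le_mul_card (f := f) (fun p hp => mem_nearMultiples.2 ?_) fun n hn => ?_
  · obtain ⟨⟨h1, h2⟩, hlt, -⟩ := mem_collisions.1 hp
    have hpos : 1 ≤ f p :=
      Nat.mul_pos (hk _ h1) (Nat.mul_pos (Nat.sub_pos_of_lt hlt) (by omega))
    refine ⟨⟨hpos, (Nat.le_add_right _ _).trans ((hf p hp).trans_le (hM _ h2))⟩, ?_⟩
    have hdiff : (f p : ℝ) * α = k p.2 * ((p.2 : ℝ) ^ 2 * α) - k p.1 * ((p.1 : ℝ) ^ 2 * α) := by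
      have hcast : (f p : ℝ) + k p.1 * (p.1 : ℝ) ^ 2 = k p.2 * (p.2 : ℝ) ^ 2 := by
        exact_mod_cast hf p hp
      linear_combination α * hcast
    rw [hdiff, two_mul]
    exact (distInt_sub_le _ _).trans (add_le_add (hZ _ h2) (hZ _ h1))
  · obtain ⟨⟨hn1, hnM⟩, -⟩ := mem_nearMultiples.1 hn
    have hfiber : #{p ∈ collisions B k | f p = n} ≤ #(n.divisors ×ˢ n.divisors) := by
      refine card_le_card_of_injOn (fun p => (p.2 - p.1, p.2 + p.1)) (fun p hp => ?_) ?_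
      · obtain ⟨-, rfl⟩ := mem_filter.1 hp
        refine mem_product.2 ⟨Nat.mem_divisors.2 ⟨?_, by omega⟩, Nat.mem_divisors.2 ⟨?_, by omega⟩⟩
        · exact ⟨k p.1 * (p.2 + p.1), by simp only [f]; ring⟩
        · exact ⟨k p.1 * (p.2 - p.1), by simp only [f]; ring⟩
      · intro p hp p' hp' h
        have hlt := (mem_collisions.1 (mem_filter.1 hp).1).2.1
        have hlt' := (mem_collisions.1 (mem_filter.1 hp').1).2.1
        rw [Prod.mk.injEq] at h
        exact Prod.ext (by omega) (by omega)
    calc (#{p ∈ collisions B k | f p = n} : ℝ) ≤ (#n.divisors : ℝ) ^ 2 := by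
          rw [card_product, ← sq] at hfiber
          exact_mod_cast hfiber
      _ ≤ τ ^ 2 := pow_le_pow_left₀ (Nat.cast_nonneg _) (hτ n (Nat.cast_le.2 hnM)) 2

end Collisions

theorem den_le_of_distInt_le {α : ℚ} {n : ℕ} {R Z : ℝ} (hn : 0 < n) (hnR : n ≤ R)
    (hZ : distInt (n * α) ≤ Z) (hZR : α.den * Z ≤ R / α.den) : α.den ≤ R := by
  by_contra! hlt
  have hα : (0 : ℝ) < α.den := Nat.cast_pos.2 α.pos
  have hnα : n < α.den := Nat.cast_lt.1 (hnR.trans_lt hlt)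
  have hne : ((n : ℤ) : ℚ) * α ≠ (round ((n : ℝ) * (α : ℝ)) : ℤ) := fun h => by
    have hdvd : α.den ∣ n := by exact_mod_cast den_dvd_of_mul_eq_intCast h
    exact hnα.not_ge (Nat.le_of_dvd hn hdvd)
  have hone : 1 ≤ α.den * distInt (n * α) := by simpa [distInt] using one_le_den_mul_abs_sub hne
  exact ((hone.trans (by gcongr)).trans hZR).not_gt ((div_lt_one hα).2 hlt)

section NearMultiples

variable {α : ℚ} {B : Finset ℕ} {k : ℕ → ℕ} {Q Z τ : ℝ} {M : ℕ}

theorem card_sq_le_of_distInt_le (hQ : 0 ≤ Q) (hZ0 : 0 ≤ Z) (hk : ∀ w ∈ B, 0 < k w ∧ k w ≤ Q)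
    (hM : ∀ w ∈ B, k w * w ^ 2 ≤ M) (hZ : ∀ w ∈ B, distInt (k w * ((w : ℝ) ^ 2 * α)) ≤ Z)
    (hτ : DivisorBound M τ) :
    (#B : ℝ) ^ 2 ≤ Q * (#B + 2 * (τ ^ 2 * ((M / α.den + 1) * (4 * α.den * Z + 1)))) := by
  have hcoll : (#(collisions B k) : ℝ) ≤ τ ^ 2 * ((M / α.den + 1) * (4 * α.den * Z + 1)) := by
    refine (card_collisions_le (fun w hw => (hk w hw).1) hM hZ hτ).trans ?_
    gcongr
    refine (card_nearMultiples_ratCast_le α M (by positivity)).trans_eq ?_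
    ring
  calc (#B : ℝ) ^ 2 ≤ ⌊Q⌋₊ * (#B + 2 * #(collisions B k)) := by
        exact_mod_cast card_sq_le_mul_card_collisions
          fun w hw => ⟨(hk w hw).1, Nat.le_floor (hk w hw).2⟩
    _ ≤ _ := by
      gcongr
      exact Nat.floor_le hQ

theorem card_le_two_mul_or_of_distInt_le {R : ℝ} (hQ : 0 ≤ Q) (hZ0 : 0 ≤ Z) (hR : 1 ≤ R)
    (hk : ∀ w ∈ B, 0 < k w ∧ k w ≤ Q) (hM : ∀ w ∈ B, k w * w ^ 2 ≤ M)
    (hZ : ∀ w ∈ B, distInt (k w * ((w : ℝ) ^ 2 * α)) ≤ Z)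
    (hτ : DivisorBound M τ) (hMR : M / α.den ≤ R) (hZR : α.den * Z ≤ R) :
    (#B : ℝ) ≤ 2 * Q ∨ (#B : ℝ) ≤ 7 * τ * √Q * R := by
  have hτ0 : 0 ≤ τ := hτ.nonneg (Nat.cast_nonneg M)
  have hsq : (#B : ℝ) ^ 2 ≤ Q * (#B + 20 * (τ * R) ^ 2) :=
    calc (#B : ℝ) ^ 2
        ≤ Q * (#B + 2 * (τ ^ 2 * ((M / α.den + 1) * (4 * α.den * Z + 1)))) :=
          card_sq_le_of_distInt_le hQ hZ0 hk hM hZ hτ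
      _ ≤ Q * (#B + 2 * (τ ^ 2 * ((R + R) * (4 * R + R)))) := by
          rw [mul_assoc 4]
          gcongr
      _ = Q * (#B + 20 * (τ * R) ^ 2) := by ring
  refine or_iff_not_imp_left.2 fun hlarge => ?_
  have hhalf : Q * #B ≤ (#B : ℝ) ^ 2 / 2 := by
    nlinarith [mul_le_mul_of_nonneg_right (not_le.1 hlarge).le (Nat.cast_nonneg (α := ℝ) #B)]
  refine (pow_le_pow_iff_left₀ (Nat.cast_nonneg _) (by positivity) two_ne_zero).1 ?_
  calc (#B : ℝ) ^ 2 ≤ 40 * Q * (τ * R) ^ 2 := by linarith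
    _ ≤ 49 * Q * (τ * R) ^ 2 := by gcongr; norm_num
    _ = (7 * τ * √Q * R) ^ 2 := by
      rw [mul_pow (7 * τ * √Q), mul_pow _ (√Q), Real.sq_sqrt hQ]
      ring

theorem card_le_of_distInt_le {W Λ : ℝ} (hQ : 0 ≤ Q) (hZ0 : 0 ≤ Z) (hW : 0 ≤ W) (hΛ : 0 < Λ)
    (hk : ∀ w ∈ B, 0 < k w ∧ k w ≤ Q) (hw : ∀ w ∈ B, 0 < w ∧ (w : ℝ) ≤ 2 * W)
    (hZ : ∀ w ∈ B, distInt (k w * ((w : ℝ) ^ 2 * α)) ≤ Z)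
    (hτ : DivisorBound (4 * Q * W ^ 2) τ) (hqZ : α.den * Z ≤ 4 * Q * W ^ 2 / α.den)
    (hqQ : 16 * (Q * Λ) ^ 2 ≤ α.den) (hqW : 28 * τ * Q * W * Λ ≤ α.den) :
    (#B : ℝ) ≤ 2 * √Q * W / Λ := by
  rcases B.eq_empty_or_nonempty with rfl | ⟨w₀, hw₀⟩
  · rw [card_empty, Nat.cast_zero]
    positivity
  have hα : (0 : ℝ) < α.den := Nat.cast_pos.2 α.pos
  have hkw : ∀ w ∈ B, (k w * w ^ 2 : ℕ) ≤ 4 * Q * W ^ 2 := fun w hwB => by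
    rw [Nat.cast_mul, Nat.cast_pow]
    calc (k w : ℝ) * w ^ 2 ≤ Q * (2 * W) ^ 2 :=
          mul_le_mul (hk w hwB).2 (pow_le_pow_left₀ (Nat.cast_nonneg _) (hw w hwB).2 2)
            (by positivity) hQ
      _ = 4 * Q * W ^ 2 := by ring
  have hqM : α.den ≤ 4 * Q * W ^ 2 :=
    den_le_of_distInt_le (Nat.mul_pos (hk w₀ hw₀).1 (pow_pos (hw w₀ hw₀).1 2)) (hkw w₀ hw₀)
      (by rw [Nat.cast_mul, Nat.cast_pow, mul_assoc]; exact hZ w₀ hw₀) hqZ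
  have hfloor : (⌊4 * Q * W ^ 2⌋₊ : ℝ) ≤ 4 * Q * W ^ 2 := Nat.floor_le (by positivity)
  rw [le_div_iff₀ hΛ]
  rcases card_le_two_mul_or_of_distInt_le hQ hZ0 ((one_le_div hα).2 hqM) hk
    (fun w hwB => Nat.le_floor (hkw w hwB)) hZ (hτ.mono hfloor)
    (div_le_div_of_nonneg_right hfloor hα.le) hqZ with hB | hB
  · calc #B * Λ ≤ 2 * Q * Λ := by gcongr
      _ ≤ 2 * √Q * W := by
        refine (pow_le_pow_iff_left₀ (by positivity) (by positivity) two_ne_zero).1 ?_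
        rw [mul_pow, mul_pow (2 * √Q), mul_pow _ (√Q), Real.sq_sqrt hQ]
        linarith
  · calc #B * Λ ≤ 7 * τ * √Q * (4 * Q * W ^ 2 / α.den) * Λ := by gcongr
      _ = 28 * τ * Q * W * Λ * (√Q * W) / α.den := by ring
      _ ≤ α.den * (√Q * W) / α.den := by gcongr
      _ = √Q * W := by field_simp
      _ ≤ 2 * √Q * W := by
        rw [mul_assoc]
        exact le_mul_of_one_le_left (by positivity) one_le_two

end NearMultiples

/-! ### Counting pairs of small height -/

section SumInvSqrt

variable {ι : Type*} {s : Finset ι} {f : ι → ℝ} {B : ℝ}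

theorem sum_one_div_sqrt_le_of_card_le {b : ℝ} (hb : 0 < b) (hf : ∀ x ∈ s, b ≤ f x) (hB : 0 ≤ B)
    (hcard : #s ≤ B * √(2 * b)) : ∑ x ∈ s, 1 / √(f x) ≤ 2 * B := by
  have hsqrt : 0 < √b := Real.sqrt_pos.2 hb
  have htwo : √(2 * b) ≤ 2 * √b := by
    rw [Real.sqrt_mul zero_le_two]
    gcongr
    exact (Real.sqrt_le_left zero_le_two).2 (by norm_num)
  calc ∑ x ∈ s, 1 / √(f x) ≤ ∑ x ∈ s, 1 / √b :=
        sum_le_sum fun x hx => one_div_le_one_div_of_le hsqrt (Real.sqrt_le_sqrt (hf x hx))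
    _ = #s / √b := by rw [sum_const, nsmul_eq_mul, mul_one_div]
    _ ≤ 2 * B := by
      rw [div_le_iff₀ hsqrt]
      calc #s ≤ B * √(2 * b) := hcard
        _ ≤ B * (2 * √b) := by gcongr
        _ = 2 * B * √b := by ring

theorem sum_one_div_sqrt_le_of_lt_two_pow {J : ℕ} (hf : ∀ x ∈ s, 1 ≤ f x ∧ f x < 2 ^ J)
    (hB : 0 ≤ B)
    (hcard : ∀ x ∈ s, ∀ y, 1 ≤ y → y ≤ 2 * f x → (#{x' ∈ s | f x' ≤ y} : ℝ) ≤ B * √y) :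
    ∑ x ∈ s, 1 / √(f x) ≤ 2 * J * B := by
  have hfloor : ∀ x ∈ s, ⌊f x⌋₊ ≠ 0 := fun x hx => (Nat.floor_pos.2 (hf x hx).1).ne'
  have hlog : ∀ x ∈ s, Nat.log 2 ⌊f x⌋₊ ∈ range J := fun x hx =>
    mem_range.2 (Nat.log_lt_of_lt_pow (hfloor x hx)
      ((Nat.floor_lt' (Nat.two_pow_pos J).ne').2 (by exact_mod_cast (hf x hx).2)))
  have hblock : ∀ i ∈ range J, ∑ x ∈ s with Nat.log 2 ⌊f x⌋₊ = i, 1 / √(f x) ≤ 2 * B := by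
    intro i _
    have hmem : ∀ x ∈ {x ∈ s | Nat.log 2 ⌊f x⌋₊ = i},
        x ∈ s ∧ 2 ^ i ≤ f x ∧ f x ≤ 2 * 2 ^ i := by
      intro x hx
      obtain ⟨hxs, rfl⟩ := mem_filter.1 hx
      refine ⟨hxs, ?_, ?_⟩
      · exact_mod_cast (Nat.le_floor_iff' (Nat.two_pow_pos _).ne').1
          (Nat.pow_log_le_self 2 (hfloor x hxs))
      · rw [← pow_succ']
        exact_mod_cast ((Nat.floor_lt (zero_le_one.trans (hf x hxs).1)).1
          (Nat.lt_pow_succ_log_self one_lt_two ⌊f x⌋₊)).le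
    rcases {x ∈ s | Nat.log 2 ⌊f x⌋₊ = i}.eq_empty_or_nonempty with hempty | ⟨x₀, hx₀⟩
    · rw [hempty, sum_empty]
      positivity
    obtain ⟨hx₀s, hix₀, -⟩ := hmem x₀ hx₀
    have hsub : {x ∈ s | Nat.log 2 ⌊f x⌋₊ = i} ⊆ {x ∈ s | f x ≤ 2 * 2 ^ i} :=
      fun x hx => mem_filter.2 ⟨(hmem x hx).1, (hmem x hx).2.2⟩
    exact sum_one_div_sqrt_le_of_card_le (by positivity) (fun x hx => (hmem x hx).2.1) hB
      ((Nat.cast_le.2 (card_le_card hsub)).trans (hcard x₀ hx₀s _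
        (by linarith [one_le_pow₀ (one_le_two (α := ℝ)) (n := i)]) (by gcongr)))
  rw [← sum_fiberwise_of_maps_to hlog]
  refine (sum_le_sum hblock).trans_eq ?_
  rw [sum_const, card_range, nsmul_eq_mul]
  ring

theorem sum_one_div_sqrt_le {Y : ℝ} (hf : ∀ x ∈ s, 1 ≤ f x) (hB : 0 ≤ B) {J : ℕ} (hY : 0 < Y)
    (hJ : Y ≤ 2 ^ J)
    (hcard : ∀ y, 1 ≤ y → y ≤ 2 * Y → (#{x ∈ s | f x ≤ y} : ℝ) ≤ B * √y) :
    ∑ x ∈ s, 1 / √(f x) ≤ #s / √Y + 2 * J * B := by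
  have hlarge : ∑ x ∈ s with ¬ f x < Y, 1 / √(f x) ≤ #s / √Y := by
    calc ∑ x ∈ s with ¬ f x < Y, 1 / √(f x) ≤ ∑ x ∈ s with ¬ f x < Y, 1 / √Y :=
          sum_le_sum fun x hx => one_div_le_one_div_of_le (Real.sqrt_pos.2 hY)
            (Real.sqrt_le_sqrt (not_lt.1 (mem_filter.1 hx).2))
      _ ≤ #s / √Y := by
        rw [sum_const, nsmul_eq_mul, mul_one_div]
        gcongr
        exact filter_subset _ _
  have hsmall : ∑ x ∈ s with f x < Y, 1 / √(f x) ≤ 2 * J * B := by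
    refine sum_one_div_sqrt_le_of_lt_two_pow (fun x hx => ?_) hB fun x hx y hy1 hy => ?_ <;>
      obtain ⟨hxs, hxY⟩ := mem_filter.1 hx
    · exact ⟨hf x hxs, hxY.trans_le hJ⟩
    · refine (Nat.cast_le.2 (card_le_card ?_)).trans (hcard y hy1 (by linarith))
      exact filter_subset_filter _ (filter_subset _ _)
  rw [← sum_filter_add_sum_filter_not s (fun x => f x < Y), add_comm (#s / √Y)]
  exact add_le_add hsmall hlarge

end SumInvSqrt

theorem card_dyadic_le {Y : ℝ} (hY : 0 ≤ Y) : (#(dyadic Y) : ℝ) ≤ 2 * Y := by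
  rw [dyadic, Nat.card_Ioc]
  exact (Nat.cast_le.2 (Nat.sub_le _ _)).trans (Nat.floor_le (by positivity))

theorem sum_one_div_sqrt_le_of_distInt_le {α : ℚ} {B : Finset ℕ} {k c : ℕ → ℕ}
    {V W Y D E Λ τ : ℝ} {J : ℕ} (hV : 0 < V) (hW : 0 ≤ W) (hY : 0 ≤ Y) (hD : 0 < D) (hE : 0 < E)
    (hΛ : 0 < Λ) (hJ : E ≤ 2 ^ J) (hB : B ⊆ dyadic W) (hk : ∀ w ∈ B, 0 < k w)
    (hc : ∀ w ∈ B, 0 < c w) (hkc : ∀ w ∈ B, (k w : ℝ) ≤ Y * c w)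
    (hZ : ∀ w ∈ B, distInt (k w * ((w : ℝ) ^ 2 * α)) ≤ Y / D * c w / V ^ 2)
    (hτ : DivisorBound (8 * (Y * E) * W ^ 2) τ) (hqD : (α.den : ℝ) ^ 2 ≤ 4 * (V * W) ^ 2 * D)
    (hqE : 64 * (Y * E * Λ) ^ 2 ≤ α.den) (hqW : 56 * τ * (Y * E) * W * Λ ≤ α.den) :
    ∑ w ∈ B, 1 / √(c w) ≤ 2 * W / √E + 2 * J * (2 * √Y * W / Λ) := by
  have hτ0 : 0 ≤ τ := hτ.nonneg (by positivity)
  have hα : (0 : ℝ) < α.den := Nat.cast_pos.2 α.pos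
  have hcard : ∀ y : ℝ, 1 ≤ y → y ≤ 2 * E → (#{w ∈ B | c w ≤ y} : ℝ) ≤ 2 * √Y * W / Λ * √y := by
    intro y hy1 hyE
    have hQ : Y * y ≤ 2 * (Y * E) := by nlinarith
    refine (card_le_of_distInt_le (α := α) (B := {w ∈ B | c w ≤ y}) (k := k) (Q := Y * y)
      (Z := Y / D * y / V ^ 2) (τ := τ) (Λ := Λ) (by positivity) (by positivity) hW hΛ
      (fun w hw => ?_) (fun w hw => ?_) (fun w hw => ?_) (hτ.mono ?_) ?_ ?_ ?_).trans_eq ?_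
    · obtain ⟨hwB, hcy⟩ := mem_filter.1 hw
      exact ⟨hk w hwB, (hkc w hwB).trans (by gcongr)⟩
    · obtain ⟨hwW, hw2W⟩ := (mem_dyadic hW w).1 (hB (mem_filter.1 hw).1)
      exact ⟨Nat.cast_pos.1 (hW.trans_lt hwW), hw2W⟩
    · obtain ⟨hwB, hcy⟩ := mem_filter.1 hw
      exact (hZ w hwB).trans (by gcongr)
    · calc 4 * (Y * y) * W ^ 2 ≤ 4 * (2 * (Y * E)) * W ^ 2 := by gcongr
        _ = 8 * (Y * E) * W ^ 2 := by ring
    · rw [le_div_iff₀ hα]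
      calc α.den * (Y / D * y / V ^ 2) * α.den = (α.den : ℝ) ^ 2 * (Y * y / (D * V ^ 2)) := by
            field_simp
        _ ≤ 4 * (V * W) ^ 2 * D * (Y * y / (D * V ^ 2)) := by gcongr
        _ = 4 * (Y * y) * W ^ 2 := by field_simp
    · calc 16 * (Y * y * Λ) ^ 2 ≤ 16 * (2 * (Y * E) * Λ) ^ 2 := by gcongr
        _ = 64 * (Y * E * Λ) ^ 2 := by ring
        _ ≤ α.den := hqE
    · calc 28 * τ * (Y * y) * W * Λ ≤ 28 * τ * (2 * (Y * E)) * W * Λ := by gcongr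
        _ = 56 * τ * (Y * E) * W * Λ := by ring
        _ ≤ α.den := hqW
    · rw [Real.sqrt_mul hY]
      ring
  refine (sum_one_div_sqrt_le (fun w hw => Nat.one_le_cast.2 (hc w hw)) (by positivity) hE hJ
    hcard).trans ?_
  gcongr
  exact (Nat.cast_le.2 (card_le_card hB)).trans (card_dyadic_le hW)

/-- The pairs `(v, w)` with `v ∼ V` and `w ∼ W` for which `r (v, w)` approximates `(vw)² α` with
height at most `Y`. -/
noncomputable def lowHeightPairs (α : ℚ) (r : ℕ × ℕ → ℚ) (V W D Y : ℝ) : Finset (ℕ × ℕ) :=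
  {p ∈ dyadic V ×ˢ dyadic W | approxHeight D (((p.1 * p.2 : ℕ) : ℝ) ^ 2 * α) (r p) ≤ Y}

section LowHeightPairs

variable {α : ℚ} {r : ℕ × ℕ → ℚ} {V W D Y τ : ℝ}

theorem mem_lowHeightPairs {p : ℕ × ℕ} : p ∈ lowHeightPairs α r V W D Y ↔
    p ∈ dyadic V ×ˢ dyadic W ∧ approxHeight D (((p.1 * p.2 : ℕ) : ℝ) ^ 2 * α) (r p) ≤ Y :=
  mem_filter

theorem card_fiber_lowHeightPairs_le_or (hV : 0 < V) (hD : 0 < D) (hY : 0 ≤ Y)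
    (hτ : DivisorBound (8 * Y * V ^ 2) τ) (w : ℕ) :
    (#{p ∈ lowHeightPairs α r V W D Y | p.2 = w} : ℝ) ≤ 72 * Y * V ^ 2 * (Y / D) * τ ∨
      ∃ k c : ℕ, 0 < k ∧ 0 < c ∧ (k : ℝ) ≤ Y * c ∧
        distInt (k * ((w : ℝ) ^ 2 * α)) ≤ Y / D * c / V ^ 2 ∧
        (#{p ∈ lowHeightPairs α r V W D Y | p.2 = w} : ℝ) ≤ τ * (2 * V / √c) := by
  have hτ0 : 0 ≤ τ := hτ.nonneg (by positivity)
  set G := {p ∈ lowHeightPairs α r V W D Y | p.2 = w} with hG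
  rcases G.eq_empty_or_nonempty with hempty | hne
  · rw [hempty, card_empty, Nat.cast_zero]
    exact .inl (by positivity)
  have hmem : ∀ v ∈ G.image Prod.fst, v ∈ dyadic V ∧
      approxHeight D (((v * w : ℕ) : ℝ) ^ 2 * α) (r (v, w)) ≤ Y := by
    simp only [mem_image, forall_exists_index, and_imp]
    rintro _ ⟨v, w'⟩ hp rfl
    obtain ⟨hlow, rfl⟩ := mem_filter.1 hp
    obtain ⟨hmem, hheight⟩ := mem_lowHeightPairs.1 hlow
    exact ⟨(mem_product.1 hmem).1, hheight⟩
  have hden : ∀ v ∈ G.image Prod.fst, ((r (v, w)).den : ℝ) ≤ Y := fun v hv =>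
    (den_le_approxHeight D _ _).trans (hmem v hv).2
  have hv2V : ∀ v ∈ G.image Prod.fst, V < v ∧ (v : ℝ) ≤ 2 * V := fun v hv =>
    (mem_dyadic hV.le v).1 (hmem v hv).1
  have hfloor : (⌊4 * Y * V ^ 2⌋₊ : ℝ) ≤ 4 * Y * V ^ 2 := Nat.floor_le (by positivity)
  have hcard : #(G.image Prod.fst) = #G := card_image_of_injOn fun p hp p' hp' h =>
    Prod.ext h ((mem_filter.1 hp).2.trans (mem_filter.1 hp').2.symm)
  rw [← hcard]
  refine (card_slice_le hV (hne.image _) hv2V hden (r := fun v => r (v, w)) (Z := Y / D)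
    (K := ⌊4 * Y * V ^ 2⌋₊) (fun v hv => Nat.le_floor ?_) (fun v hv => ?_)
    (hτ.mono (by linarith))).imp_left fun h => h.trans ?_
  · rw [Nat.cast_mul, Nat.cast_pow]
    calc ((r (v, w)).den : ℝ) * v ^ 2 ≤ Y * (2 * V) ^ 2 := by
          gcongr
          exacts [hden v hv, (hv2V v hv).2]
      _ = 4 * Y * V ^ 2 := by ring
  · rw [← mul_assoc, ← mul_pow, ← Nat.cast_mul]
    exact (den_mul_abs_sub_le_approxHeight hD _ _).trans (by gcongr; exact (hmem v hv).2)
  · calc 18 * (⌊4 * Y * V ^ 2⌋₊ : ℝ) * (Y / D) * τ ≤ 18 * (4 * Y * V ^ 2) * (Y / D) * τ := by gcongr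
      _ = 72 * Y * V ^ 2 * (Y / D) * τ := by ring

theorem card_lowHeightPairs_le {E Λ : ℝ} {J : ℕ} (hV : 0 < V) (hW : 0 ≤ W) (hY : 0 ≤ Y)
    (hD : 0 < D) (hE : 0 < E) (hΛ : 0 < Λ) (hJ : E ≤ 2 ^ J)
    (hτV : DivisorBound (8 * Y * V ^ 2) τ) (hτW : DivisorBound (8 * (Y * E) * W ^ 2) τ)
    (hqD : (α.den : ℝ) ^ 2 ≤ 4 * (V * W) ^ 2 * D) (hqE : 64 * (Y * E * Λ) ^ 2 ≤ α.den)
    (hqW : 56 * τ * (Y * E) * W * Λ ≤ α.den) :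
    (#(lowHeightPairs α r V W D Y) : ℝ) ≤ 2 * W * (72 * Y * V ^ 2 * (Y / D) * τ) +
      τ * (2 * V) * (2 * W / √E + 2 * J * (2 * √Y * W / Λ)) := by
  have hτ0 : 0 ≤ τ := hτV.nonneg (by positivity)
  set F : ℕ → ℝ := fun w => (#{p ∈ lowHeightPairs α r V W D Y | p.2 = w} : ℝ)
  set b := 72 * Y * V ^ 2 * (Y / D) * τ
  have hfew : ∑ w ∈ dyadic W with F w ≤ b, F w ≤ 2 * W * b :=
    calc ∑ w ∈ dyadic W with F w ≤ b, F w ≤ #{w ∈ dyadic W | F w ≤ b} * b := by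
          rw [← nsmul_eq_mul]
          exact sum_le_card_nsmul _ _ _ fun w hw => (mem_filter.1 hw).2
      _ ≤ 2 * W * b := by
          gcongr
          exact (Nat.cast_le.2 (card_filter_le _ _)).trans (card_dyadic_le hW)
  have hmany : ∀ w ∈ {w ∈ dyadic W | ¬ F w ≤ b}, ∃ k c : ℕ, 0 < k ∧ 0 < c ∧ (k : ℝ) ≤ Y * c ∧
      distInt (k * ((w : ℝ) ^ 2 * α)) ≤ Y / D * c / V ^ 2 ∧ F w ≤ τ * (2 * V / √c) := fun w hw =>
    (card_fiber_lowHeightPairs_le_or hV hD hY hτV w).resolve_left (mem_filter.1 hw).2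
  choose! k c hk hc hkc hdist hF using hmany
  rw [card_eq_sum_card_fiberwise (f := Prod.snd) fun p hp =>
    (mem_product.1 (mem_lowHeightPairs.1 hp).1).2, Nat.cast_sum,
    ← sum_filter_add_sum_filter_not (dyadic W) (fun w => F w ≤ b)]
  refine add_le_add hfew ?_
  calc ∑ w ∈ dyadic W with ¬ F w ≤ b, F w
      ≤ ∑ w ∈ dyadic W with ¬ F w ≤ b, τ * (2 * V) * (1 / √(c w)) :=
        sum_le_sum fun w hw => (hF w hw).trans_eq (by ring)
    _ ≤ τ * (2 * V) * (2 * W / √E + 2 * J * (2 * √Y * W / Λ)) := by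
        rw [← mul_sum]
        gcongr
        exact sum_one_div_sqrt_le_of_distInt_le hV hW hY hD hE hΛ hJ (filter_subset _ _) hk hc hkc
          hdist hτW hqD hqE hqW

end LowHeightPairs

/-- The contribution to `T` of the pairs `(v, w)` with product `m`: the first moment over `ℓ ≤ L`
of the inner sum. -/
noncomputable def firstMoment (a : ℤ) (q : ℕ) (β γ N L : ℝ) (S : ℕ → Set ℝ) (m : ℕ) : ℝ :=
  ∑ l ∈ Icc 1 ⌊L⌋₊, ‖∑ n ∈ integersIn N S m, e (l * g a q β γ (m * n))‖

section TrivialBound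

variable (a : ℤ) (q : ℕ) (β γ : ℝ) {N L V W : ℝ} (S : ℕ → Set ℝ)

theorem T_eq_sum_firstMoment (N L V W : ℝ) : T a q β γ N L V W S =
    ∑ p ∈ dyadic V ×ˢ dyadic W, firstMoment a q β γ N L S (p.1 * p.2) := by
  simp only [T, firstMoment, Nat.cast_mul]
  rw [sum_comm]
  simp only [sum_product, sum_comm (s := Icc 1 ⌊L⌋₊)]

theorem card_product_dyadic_le (hV : 0 ≤ V) (hW : 0 ≤ W) :
    (#(dyadic V ×ˢ dyadic W) : ℝ) ≤ 4 * (V * W) := by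
  rw [card_product, Nat.cast_mul]
  calc (#(dyadic V) : ℝ) * #(dyadic W) ≤ 2 * V * (2 * W) :=
        mul_le_mul (card_dyadic_le hV) (card_dyadic_le hW) (Nat.cast_nonneg _) (by positivity)
    _ = 4 * (V * W) := by ring

theorem card_integersIn_le (hN : 0 ≤ N) (m : ℕ) : (#(integersIn N S m) : ℝ) ≤ N := by
  refine le_trans (Nat.cast_le.2 ?_) (Nat.floor_le hN)
  have hsub : integersIn N S m ⊆ Icc 1 ⌊N / m⌋₊ := by
    classical exact filter_subset _ _
  calc #(integersIn N S m) ≤ ⌊N / m⌋₊ := (card_le_card hsub).trans_eq (Nat.card_Icc _ _)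
    _ = ⌊N⌋₊ / m := Nat.floor_div_natCast N m
    _ ≤ ⌊N⌋₊ := Nat.div_le_self _ _

theorem firstMoment_le_mul (hN : 0 ≤ N) (hL : 0 ≤ L) (m : ℕ) :
    firstMoment a q β γ N L S m ≤ L * N := by
  have hterm : ∀ l ∈ Icc 1 ⌊L⌋₊, ‖∑ n ∈ integersIn N S m, e (l * g a q β γ (m * n))‖ ≤ N :=
    fun l _ => (norm_sum_le _ _).trans <| by
      simpa only [norm_e, sum_const, nsmul_one] using card_integersIn_le S hN m
  calc firstMoment a q β γ N L S m ≤ #(Icc 1 ⌊L⌋₊) • N := sum_le_card_nsmul _ _ _ hterm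
    _ ≤ L * N := by
      rw [nsmul_eq_mul, Nat.card_Icc, Nat.add_sub_cancel]
      gcongr
      exact Nat.floor_le hL

theorem T_le_mul (hN : 0 ≤ N) (hL : 0 ≤ L) (hV : 0 ≤ V) (hW : 0 ≤ W) :
    T a q β γ N L V W S ≤ 4 * (V * W) * (L * N) := by
  rw [T_eq_sum_firstMoment]
  calc ∑ p ∈ dyadic V ×ˢ dyadic W, firstMoment a q β γ N L S (p.1 * p.2)
      ≤ #(dyadic V ×ˢ dyadic W) • (L * N) :=
        sum_le_card_nsmul _ _ _ fun p _ => firstMoment_le_mul a q β γ S hN hL _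
    _ ≤ 4 * (V * W) * (L * N) := by
      rw [nsmul_eq_mul]
      gcongr
      exact card_product_dyadic_le hV hW

end TrivialBound

/-! ### Bounding `T` under the size conditions -/

/-- The range of parameters in which the bound for `T` holds. The single quantity `P` stands for
`N ^ η`: it absorbs constants, logarithms and divisor functions, and a power of it is the margin in
every size condition. -/
structure IsAdmissible (q : ℕ) (N L V W P : ℝ) : Prop where
  le_P : 1000 ≤ P
  exists_le_two_pow : ∃ J : ℕ, N ≤ 2 ^ J ∧ J + 2 ≤ P
  divisorBound : DivisorBound (N ^ 4) P
  one_le_L : 1 ≤ L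
  one_le_V : 1 ≤ V
  one_le_W : 1 ≤ W
  mul_VW_le : P ^ 200 * L ^ 2 * (V * W) ≤ N
  mul_V_cube_W_sq_le : P ^ 200 * L ^ 3 * (V ^ 3 * W ^ 2) ≤ N ^ 2
  mul_L_pow_le : P ^ 200 * L ^ 6 ≤ q
  mul_W_le : P ^ 200 * L ^ 3 * W ≤ q
  sq_le : (q : ℝ) ^ 2 ≤ 4 * L * N ^ 2

namespace IsAdmissible

variable {q : ℕ} {N L V W P : ℝ}

theorem one_le_P (h : IsAdmissible q N L V W P) : 1 ≤ P := by linarith [h.le_P]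

theorem const_mul_pow_le (h : IsAdmissible q N L V W P) {c : ℝ} (hc : c ≤ 1000 ^ 2) {k : ℕ}
    (hk : k ≤ 198) : c * P ^ k ≤ P ^ 200 := by
  have hP := h.one_le_P
  calc c * P ^ k ≤ P ^ 2 * P ^ 198 := by
        gcongr
        exact hc.trans (pow_le_pow_left₀ (by norm_num) h.le_P 2)
    _ = P ^ 200 := by ring

theorem pow_mul_VW_le (h : IsAdmissible q N L V W P) {k : ℕ} (hk : k ≤ 200) :
    P ^ k * L ^ 2 * (V * W) ≤ N := by
  have := h.one_le_V
  have := h.one_le_W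
  refine le_trans ?_ h.mul_VW_le
  gcongr
  exact h.one_le_P

theorem pow_mul_sq_le (h : IsAdmissible q N L V W P) {k : ℕ} (hk : k ≤ 200) :
    P ^ k * L ^ 2 ≤ N := by
  have := h.one_le_P
  exact (le_mul_of_one_le_right (by positivity)
    (one_le_mul_of_one_le_of_one_le h.one_le_V h.one_le_W)).trans (h.pow_mul_VW_le hk)

theorem VW_le (h : IsAdmissible q N L V W P) : V * W ≤ N := by
  have := h.one_le_V
  have := h.one_le_W
  have hle := h.pow_mul_VW_le (Nat.zero_le _)
  rw [pow_zero, one_mul] at hle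
  exact (le_mul_of_one_le_left (by positivity) (one_le_pow₀ h.one_le_L)).trans hle

theorem V_le (h : IsAdmissible q N L V W P) : V ≤ N :=
  (le_mul_of_one_le_right (zero_le_one.trans h.one_le_V) h.one_le_W).trans h.VW_le

theorem W_le (h : IsAdmissible q N L V W P) : W ≤ N :=
  (le_mul_of_one_le_left (zero_le_one.trans h.one_le_W) h.one_le_V).trans h.VW_le

theorem L_le (h : IsAdmissible q N L V W P) : L ≤ N := by
  have hle := h.pow_mul_sq_le (Nat.zero_le _)
  rw [pow_zero, one_mul] at hle
  exact (le_self_pow₀ h.one_le_L two_ne_zero).trans hle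

theorem le_N (h : IsAdmissible q N L V W P) : 1000 ≤ N := by
  refine (h.le_P.trans ?_).trans (h.pow_mul_sq_le (k := 1) (by norm_num))
  rw [pow_one]
  exact le_mul_of_one_le_right (zero_le_one.trans h.one_le_P) (one_le_pow₀ h.one_le_L)

section LowHeightPairs

variable {s : ℝ}

theorem slice_term_le (h : IsAdmissible q N L V W P) (hs : 0 ≤ s) (hsL : s ≤ 2 * (L * P ^ 15)) :
    2 * W * (72 * s ^ 2 * V ^ 2 * (s ^ 2 / (L * (N / (V * W)) ^ 2)) * P)
      ≤ V * W / (L * P ^ 15) * s / 3 := by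
  have := h.one_le_P
  have := h.one_le_L
  have := h.one_le_V
  have := h.one_le_W
  have := h.le_N
  have hsize : 432 * P ^ 16 * s ^ 3 * (V ^ 3 * W ^ 2) ≤ N ^ 2 := by
    refine le_trans ?_ h.mul_V_cube_W_sq_le
    calc 432 * P ^ 16 * s ^ 3 * (V ^ 3 * W ^ 2)
        ≤ 432 * P ^ 16 * (2 * (L * P ^ 15)) ^ 3 * (V ^ 3 * W ^ 2) := by gcongr
      _ = 3456 * P ^ 61 * L ^ 3 * (V ^ 3 * W ^ 2) := by ring
      _ ≤ P ^ 200 * L ^ 3 * (V ^ 3 * W ^ 2) := by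
        gcongr
        exact h.const_mul_pow_le (by norm_num) (by norm_num)
  calc 2 * W * (72 * s ^ 2 * V ^ 2 * (s ^ 2 / (L * (N / (V * W)) ^ 2)) * P)
      = 432 * P ^ 16 * s ^ 3 * (V ^ 3 * W ^ 2) * (V * W * s / (3 * L * P ^ 15 * N ^ 2)) := by
        field_simp
        ring
    _ ≤ N ^ 2 * (V * W * s / (3 * L * P ^ 15 * N ^ 2)) := by gcongr
    _ = V * W / (L * P ^ 15) * s / 3 := by field_simp

theorem pair_term_le (h : IsAdmissible q N L V W P) (hs : 0 < s) {J : ℕ} (hJ : J + 2 ≤ P) :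
    P * (2 * V) * (2 * W / (L * P ^ 20 / s) + 2 * J * (2 * s * W / (L * P ^ 20)))
      ≤ 2 * (V * W / (L * P ^ 15) * s / 3) := by
  have := h.one_le_P
  have := h.one_le_L
  have := h.one_le_V
  have := h.one_le_W
  have hJP : (12 + 24 * J) / P ^ 4 ≤ 2 := by
    rw [div_le_iff₀ (by positivity)]
    nlinarith [h.le_P, le_self_pow₀ h.one_le_P two_ne_zero,
      pow_le_pow_right₀ h.one_le_P (show 2 ≤ 4 by norm_num)]
  calc P * (2 * V) * (2 * W / (L * P ^ 20 / s) + 2 * J * (2 * s * W / (L * P ^ 20)))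
      = (12 + 24 * J) / P ^ 4 * (V * W / (L * P ^ 15) * s / 3) := by
        field_simp
        ring
    _ ≤ 2 * (V * W / (L * P ^ 15) * s / 3) := by gcongr

theorem sq_le_N (h : IsAdmissible q N L V W P) (hs : 0 ≤ s) (hsL : s ≤ 2 * (L * P ^ 15)) :
    s ^ 2 ≤ N := by
  have := h.one_le_P
  calc s ^ 2 ≤ (2 * (L * P ^ 15)) ^ 2 := by gcongr
    _ = 4 * (P ^ 30 * L ^ 2) := by ring
    _ ≤ P * (P ^ 30 * L ^ 2) := by gcongr; linarith [h.le_P]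
    _ = P ^ 31 * L ^ 2 := by ring
    _ ≤ N := h.pow_mul_sq_le (by norm_num)

theorem const_mul_sq_le_q (h : IsAdmissible q N L V W P) :
    64 * (P ^ 40 * L ^ 2 * (L * P ^ 20)) ^ 2 ≤ q := by
  have := h.one_le_L
  calc 64 * (P ^ 40 * L ^ 2 * (L * P ^ 20)) ^ 2 = 64 * P ^ 120 * L ^ 6 := by ring
    _ ≤ P ^ 200 * L ^ 6 := by
      gcongr
      exact h.const_mul_pow_le (by norm_num) (by norm_num)
    _ ≤ q := h.mul_L_pow_le

theorem const_mul_W_le_q (h : IsAdmissible q N L V W P) :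
    56 * P * (P ^ 40 * L ^ 2) * W * (L * P ^ 20) ≤ q := by
  have := h.one_le_L
  have := h.one_le_W
  calc 56 * P * (P ^ 40 * L ^ 2) * W * (L * P ^ 20) = 56 * P ^ 61 * L ^ 3 * W := by ring
    _ ≤ P ^ 200 * L ^ 3 * W := by
      gcongr
      exact h.const_mul_pow_le (by norm_num) (by norm_num)
    _ ≤ q := h.mul_W_le

theorem card_lowHeightPairs_le {α : ℚ} {r : ℕ × ℕ → ℚ} (h : IsAdmissible α.den N L V W P)
    (hs : 1 ≤ s) (hsL : s ≤ 2 * (L * P ^ 15)) :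
    (#(lowHeightPairs α r V W (L * (N / (V * W)) ^ 2) (s ^ 2)) : ℝ)
      ≤ V * W / (L * P ^ 15) * s := by
  have hP := h.one_le_P
  have hL := h.one_le_L
  have hV := h.one_le_V
  have hW := h.one_le_W
  have hN := h.le_N
  obtain ⟨J, hJ, hJP⟩ := h.exists_le_two_pow
  have hE : s ^ 2 * (L * P ^ 20 / s) ^ 2 = P ^ 40 * L ^ 2 := by field_simp
  have hEN : (L * P ^ 20 / s) ^ 2 ≤ N := by
    refine le_trans ?_ (h.pow_mul_sq_le (k := 40) (by norm_num))
    rw [← hE]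
    exact le_mul_of_one_le_left (by positivity) (one_le_pow₀ hs)
  have hcard := TypeI.card_lowHeightPairs_le (α := α) (r := r) (V := V) (W := W) (Y := s ^ 2)
    (τ := P) (D := L * (N / (V * W)) ^ 2) (E := (L * P ^ 20 / s) ^ 2) (Λ := L * P ^ 20) (J := J)
    (by positivity) (by positivity) (by positivity) (by positivity) (by positivity)
    (by positivity) (hEN.trans hJ) (h.divisorBound.mono ?_) (h.divisorBound.mono ?_)
    (h.sq_le.trans_eq (by field_simp)) (hE ▸ h.const_mul_sq_le_q) (hE ▸ h.const_mul_W_le_q)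
  · rw [Real.sqrt_sq (by positivity), Real.sqrt_sq (by positivity)] at hcard
    linarith [h.slice_term_le (zero_le_one.trans hs) hsL, h.pair_term_le (by positivity) hJP]
  · calc 8 * s ^ 2 * V ^ 2 ≤ N * N * N ^ 2 := by
          gcongr
          exacts [by linarith, h.sq_le_N (by positivity) hsL, h.V_le]
      _ = N ^ 4 := by ring
  · rw [hE]
    calc 8 * (P ^ 40 * L ^ 2) * W ^ 2 ≤ N * N * N ^ 2 := by
          gcongr
          exacts [by linarith, h.pow_mul_sq_le (by norm_num), h.W_le]
      _ = N ^ 4 := by ring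

end LowHeightPairs

section FirstMoment

variable {S : ℕ → Set ℝ} {m : ℕ} {r : ℚ}

theorem mean_square_terms_le (h : IsAdmissible q N L V W P) {x d i : ℝ} (hx : 0 ≤ x)
    (hd : 0 ≤ d) (hi : i + 1 ≤ P) :
    2 * (x + P * ((i + 1) * (36 * x + 4 * d))) ≤ P ^ 4 * (x + d) := by
  have hP := h.one_le_P
  have hP2 : 1000 ≤ P ^ 2 := h.le_P.trans (le_self_pow₀ hP two_ne_zero)
  calc 2 * (x + P * ((i + 1) * (36 * x + 4 * d)))
      ≤ 2 * (P ^ 2 * x + P * (P * (36 * x + 4 * d))) := by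
        gcongr
        exact le_mul_of_one_le_left hx (one_le_pow₀ hP)
    _ = P ^ 2 * (74 * x + 8 * d) := by ring
    _ ≤ P ^ 2 * (1000 * (x + d)) := by gcongr; linarith
    _ ≤ P ^ 2 * (P ^ 2 * (x + d)) := by gcongr
    _ = P ^ 4 * (x + d) := by ring

theorem sum_norm_sq_le (h : IsAdmissible q N L V W P) (hS : IsSubintervalFamily N S)
    (hm : V * W ≤ m) (a : ℤ) (b : ℕ) (β γ : ℝ)
    (hr : IsDirichletApprox ((m : ℝ) ^ 2 * (a / b)) (2 * (2 * ⌊L⌋₊ * ⌊N / (V * W)⌋₊)) r) :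
    ∑ l ∈ Icc 1 ⌊L⌋₊, ‖∑ n ∈ integersIn N S m, e (l * g a b β γ (m * n))‖ ^ 2
      ≤ P ^ 4 * (L * (N / (V * W)) + L * (N / (V * W)) ^ 2 /
          approxHeight (L * (N / (V * W)) ^ 2) ((m : ℝ) ^ 2 * (a / b)) r) := by
  have hL := h.one_le_L
  have hN := h.le_N
  have hVW := one_le_mul_of_one_le_of_one_le h.one_le_V h.one_le_W
  set H := N / (V * W) with hHdef
  have hH : 1 ≤ H := (one_le_div (by positivity)).2 h.VW_le
  have hHN : H ≤ N := div_le_self (by positivity) hVW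
  have hheight := one_le_approxHeight (L * H ^ 2) ((m : ℝ) ^ 2 * (a / b)) r
  obtain ⟨J, hJ, hJP⟩ := h.exists_le_two_pow
  obtain ⟨i, hi, hHi⟩ := exists_nat_pow_near hH one_lt_two
  have hiJ : i ≤ J := (pow_le_pow_iff_right₀ one_lt_two).1 (hi.trans (hHN.trans hJ))
  have hiP : ((i + 1 : ℕ) : ℝ) + 1 ≤ P := by
    rify at hiJ
    push_cast
    linarith
  have hK : ((2 * ⌊L⌋₊ * ⌊H⌋₊ : ℕ) : ℝ) ≤ N ^ 4 := by
    push_cast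
    calc (2 : ℝ) * ⌊L⌋₊ * ⌊H⌋₊ ≤ N ^ 2 * N * N := by
          gcongr
          exacts [by nlinarith, (Nat.floor_le (by positivity)).trans h.L_le,
            (Nat.floor_le (by positivity)).trans hHN]
      _ = N ^ 4 := by ring
  have hm0 : 0 < m := Nat.cast_pos.1 ((zero_lt_one.trans_le hVW).trans_le hm)
  refine (TypeI.sum_norm_sq_le (by positivity) hS hm0 (by rw [hHdef]; gcongr) (by positivity)
    (by positivity) hHi.le ?_ a b β γ hr (h.divisorBound.mono hK)).trans ?_
  · rw [pow_succ, mul_comm]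
    gcongr
  · rw [mul_div_assoc]
    exact h.mean_square_terms_le (by positivity) (by positivity) hiP

theorem firstMoment_le (h : IsAdmissible q N L V W P) (hS : IsSubintervalFamily N S)
    (hm : V * W ≤ m) (a : ℤ) (b : ℕ) (β γ : ℝ)
    (hr : IsDirichletApprox ((m : ℝ) ^ 2 * (a / b)) (2 * (2 * ⌊L⌋₊ * ⌊N / (V * W)⌋₊)) r) :
    firstMoment a b β γ N L S m ≤ P ^ 2 * L * √(N / (V * W)) +
      P ^ 2 * L * (N / (V * W)) *
        (1 / √(approxHeight (L * (N / (V * W)) ^ 2) ((m : ℝ) ^ 2 * (a / b)) r)) := by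
  have hP := h.one_le_P
  have hL := h.one_le_L
  have hH : 0 ≤ N / (V * W) := zero_le_one.trans
    ((one_le_div (by have := h.one_le_V; have := h.one_le_W; positivity)).2 h.VW_le)
  set H := N / (V * W)
  set y := approxHeight (L * H ^ 2) ((m : ℝ) ^ 2 * (a / b)) r
  have hy0 : 0 < y := zero_lt_one.trans_le (one_le_approxHeight _ _ _)
  refine le_of_sq_le_sq ?_ (by positivity)
  calc firstMoment a b β γ N L S m ^ 2
      ≤ #(Icc 1 ⌊L⌋₊) * ∑ l ∈ Icc 1 ⌊L⌋₊, ‖∑ n ∈ integersIn N S m, e (l * g a b β γ (m * n))‖ ^ 2 :=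
        sq_sum_le_card_mul_sum_sq
    _ ≤ L * (P ^ 4 * (L * H + L * H ^ 2 / y)) := by
        rw [Nat.card_Icc, Nat.add_sub_cancel]
        gcongr
        exacts [Nat.floor_le (by positivity), h.sum_norm_sq_le hS hm a b β γ hr]
    _ = (P ^ 2 * L) ^ 2 * √H ^ 2 + (P ^ 2 * L * H) ^ 2 * (1 / √y) ^ 2 := by
        rw [Real.sq_sqrt hH, div_pow 1, Real.sq_sqrt hy0.le]
        ring
    _ = (P ^ 2 * L * √H) ^ 2 + (P ^ 2 * L * H * (1 / √y)) ^ 2 := by ring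
    _ ≤ (P ^ 2 * L * √H + P ^ 2 * L * H * (1 / √y)) ^ 2 :=
        pow_add_pow_le (by positivity) (by positivity) two_ne_zero

end FirstMoment

theorem sum_one_div_sqrt_approxHeight_le {α : ℚ} (h : IsAdmissible α.den N L V W P)
    (r : ℕ × ℕ → ℚ) :
    ∑ p ∈ dyadic V ×ˢ dyadic W,
        1 / √(approxHeight (L * (N / (V * W)) ^ 2) (((p.1 * p.2 : ℕ) : ℝ) ^ 2 * α) (r p))
      ≤ 4 * (V * W) / (L * P ^ 14) := by
  have hP := h.one_le_P
  have hL := h.one_le_L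
  have hV := h.one_le_V
  have hW := h.one_le_W
  obtain ⟨J, hJ, hJP⟩ := h.exists_le_two_pow
  have hY : (L * P ^ 15) ^ 2 ≤ 2 ^ J :=
    calc (L * P ^ 15) ^ 2 = P ^ 30 * L ^ 2 := by ring
      _ ≤ N := h.pow_mul_sq_le (by norm_num)
      _ ≤ 2 ^ J := hJ
  refine (sum_one_div_sqrt_le (B := V * W / (L * P ^ 15)) (fun p _ => one_le_approxHeight _ _ _)
    (by positivity) (by positivity) hY fun y hy hyY => ?_).trans ?_
  · have hs : √y ≤ 2 * (L * P ^ 15) := by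
      rw [Real.sqrt_le_left (by positivity)]
      nlinarith
    have hcard := h.card_lowHeightPairs_le (r := r) (Real.one_le_sqrt.2 hy) hs
    rwa [Real.sq_sqrt (by positivity)] at hcard
  · rw [Real.sqrt_sq (by positivity)]
    calc #(dyadic V ×ˢ dyadic W) / (L * P ^ 15) + 2 * J * (V * W / (L * P ^ 15))
        ≤ 4 * (V * W) / (L * P ^ 15) + 2 * J * (V * W / (L * P ^ 15)) := by
          gcongr
          exact card_product_dyadic_le (by positivity) (by positivity)
      _ = (4 + 2 * J) * (V * W / (L * P ^ 15)) := by ring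
      _ ≤ 4 * P * (V * W / (L * P ^ 15)) := by gcongr; linarith
      _ = 4 * (V * W) / (L * P ^ 14) := by field_simp

theorem VW_mul_sqrt_le (h : IsAdmissible q N L V W P) :
    V * W * (P ^ 14 * L * √(N / (V * W))) ≤ N := by
  have hV := h.one_le_V
  have hW := h.one_le_W
  have hN := h.le_N
  refine le_of_sq_le_sq ?_ (by positivity)
  calc (V * W * (P ^ 14 * L * √(N / (V * W)))) ^ 2
      = P ^ 28 * L ^ 2 * (V * W) * (V * W * √(N / (V * W)) ^ 2) := by ring
    _ = P ^ 28 * L ^ 2 * (V * W) * N := by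
      rw [Real.sq_sqrt (by positivity), mul_div_cancel₀ _ (by positivity)]
    _ ≤ N * N := by
      gcongr
      exact h.pow_mul_VW_le (by norm_num)
    _ = N ^ 2 := (sq N).symm

theorem exists_firstMoment_le {α : ℚ} {S : ℕ → Set ℝ} (h : IsAdmissible α.den N L V W P)
    (hS : IsSubintervalFamily N S) (β γ : ℝ) :
    ∃ r : ℕ × ℕ → ℚ, ∀ p ∈ dyadic V ×ˢ dyadic W,
      firstMoment α.num α.den β γ N L S (p.1 * p.2) ≤ P ^ 2 * L * √(N / (V * W)) +
        P ^ 2 * L * (N / (V * W)) *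
          (1 / √(approxHeight (L * (N / (V * W)) ^ 2) (((p.1 * p.2 : ℕ) : ℝ) ^ 2 * α) (r p))) := by
  have hV := h.one_le_V
  have hW := h.one_le_W
  have hH : 1 ≤ N / (V * W) := (one_le_div (by positivity)).2 h.VW_le
  have hn : 0 < 2 * (2 * ⌊L⌋₊ * ⌊N / (V * W)⌋₊) := by
    have := Nat.floor_pos.2 h.one_le_L
    have := Nat.floor_pos.2 hH
    positivity
  choose r hr using fun p : ℕ × ℕ =>
    exists_isDirichletApprox (((p.1 * p.2 : ℕ) : ℝ) ^ 2 * (α.num / α.den)) hn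
  refine ⟨r, fun p hp => ?_⟩
  rw [mem_product, mem_dyadic (by positivity), mem_dyadic (by positivity)] at hp
  rw [Rat.cast_def α]
  refine h.firstMoment_le hS ?_ _ _ β γ (hr p)
  push_cast
  gcongr
  exacts [hp.1.1.le, hp.2.1.le]

theorem T_le {α : ℚ} {S : ℕ → Set ℝ} (h : IsAdmissible α.den N L V W P)
    (hS : IsSubintervalFamily N S) (β γ : ℝ) :
    T α.num α.den β γ N L V W S ≤ N / P ^ 10 := by
  have hP := h.one_le_P
  have hL := h.one_le_L
  have hV := h.one_le_V
  have hW := h.one_le_W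
  have hN := h.le_N
  obtain ⟨r, hr⟩ := h.exists_firstMoment_le hS β γ
  rw [T_eq_sum_firstMoment]
  refine (sum_le_sum hr).trans ?_
  rw [sum_add_distrib, sum_const, nsmul_eq_mul, ← mul_sum]
  calc #(dyadic V ×ˢ dyadic W) * (P ^ 2 * L * √(N / (V * W))) + P ^ 2 * L * (N / (V * W)) *
        ∑ p ∈ dyadic V ×ˢ dyadic W, 1 /
          √(approxHeight (L * (N / (V * W)) ^ 2) (((p.1 * p.2 : ℕ) : ℝ) ^ 2 * α) (r p))
      ≤ 4 * (V * W) * (P ^ 2 * L * √(N / (V * W))) +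
        P ^ 2 * L * (N / (V * W)) * (4 * (V * W) / (L * P ^ 14)) := by
        gcongr
        exacts [card_product_dyadic_le (by positivity) (by positivity),
          h.sum_one_div_sqrt_approxHeight_le r]
    _ = 4 * (V * W * (P ^ 14 * L * √(N / (V * W))) + N) / P ^ 12 := by field_simp
    _ ≤ 4 * (N + N) / P ^ 12 := by gcongr; exact h.VW_mul_sqrt_le
    _ = 8 / P ^ 2 * (N / P ^ 10) := by field_simp; norm_num
    _ ≤ N / P ^ 10 := mul_le_of_le_one_left (by positivity) <| by
        rw [div_le_one (by positivity)]
        nlinarith [h.le_P]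

end IsAdmissible

/-! ### Exponents -/

section DivisorBound

variable {δ : ℝ}

theorem add_one_le_mul_rpow_pow {c x : ℝ} (hδ : 0 < δ) (hc1 : 1 ≤ c)
    (hc : 1 ≤ c * (δ * Real.log 2)) (hx : 2 ≤ x) (k : ℕ) : (k + 1 : ℝ) ≤ c * (x ^ δ) ^ k :=
  calc (k + 1 : ℝ) ≤ k * (c * (δ * Real.log 2)) + c := by
        gcongr
        exact le_mul_of_one_le_right (Nat.cast_nonneg k) hc
    _ = c * (k * (Real.log 2 * δ) + 1) := by ring
    _ ≤ c * ((2 : ℝ) ^ δ) ^ k := by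
        rw [Real.rpow_def_of_pos two_pos, ← Real.exp_nat_mul]
        gcongr
        exact Real.add_one_le_exp _
    _ ≤ c * (x ^ δ) ^ k := by gcongr

theorem add_one_le_rpow_pow {x : ℝ} (hδ : 0 < δ) (hx : 2 ^ (1 / δ) ≤ x) (k : ℕ) :
    (k + 1 : ℝ) ≤ (x ^ δ) ^ k := by
  have hxδ : 2 ≤ x ^ δ :=
    calc (2 : ℝ) = (2 ^ (1 / δ)) ^ δ := by
          rw [← Real.rpow_mul zero_le_two, one_div_mul_cancel hδ.ne', Real.rpow_one]
      _ ≤ x ^ δ := by gcongr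
  calc (k + 1 : ℝ) ≤ 2 ^ k := mod_cast Nat.lt_two_pow_self (n := k)
    _ ≤ (x ^ δ) ^ k := by gcongr

theorem prod_primeFactors_rpow_pow {n : ℕ} (hn : n ≠ 0) (δ : ℝ) :
    ∏ p ∈ n.primeFactors, ((p : ℝ) ^ δ) ^ n.factorization p = (n : ℝ) ^ δ := by
  have hpow : ∀ p ∈ n.primeFactors,
      ((p : ℝ) ^ δ) ^ n.factorization p = ((p ^ n.factorization p : ℕ) : ℝ) ^ δ := fun p _ => by
    rw [Nat.cast_pow, Real.rpow_pow_comm (Nat.cast_nonneg p)]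
  rw [prod_congr rfl hpow, Real.finsetProd_rpow _ _ fun _ _ => Nat.cast_nonneg _, ← Nat.cast_prod]
  congr 2
  exact Nat.prod_factorization_pow_eq_self hn

theorem exists_card_divisors_le (hδ : 0 < δ) :
    ∃ C : ℝ, ∀ n : ℕ, (#n.divisors : ℝ) ≤ C * (n : ℝ) ^ δ := by
  have : 0 < Real.log 2 := Real.log_pos one_lt_two
  set c : ℝ := max 1 (1 / (δ * Real.log 2))
  have hc1 : 1 ≤ c := le_max_left _ _
  have hc : 1 ≤ c * (δ * Real.log 2) := (div_le_iff₀ (by positivity)).1 (le_max_right _ _)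
  set p₀ : ℕ := ⌈(2 : ℝ) ^ (1 / δ)⌉₊
  refine ⟨c ^ p₀, fun n => ?_⟩
  rcases eq_or_ne n 0 with rfl | hn
  · simp only [Nat.divisors_zero, card_empty, Nat.cast_zero]
    positivity
  have hfactor : ∀ p ∈ n.primeFactors, (n.factorization p + 1 : ℝ) ≤
      (if p < p₀ then c else 1) * ((p : ℝ) ^ δ) ^ n.factorization p := by
    intro p hp
    split_ifs with hlt
    · exact add_one_le_mul_rpow_pow hδ hc1 hc
        (mod_cast (Nat.prime_of_mem_primeFactors hp).two_le) _
    · rw [one_mul]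
      exact add_one_le_rpow_pow hδ (Nat.ceil_le.1 (not_lt.1 hlt)) _
  have hsmall : #{p ∈ n.primeFactors | p < p₀} ≤ p₀ :=
    calc #{p ∈ n.primeFactors | p < p₀} ≤ #(range p₀) :=
          card_le_card fun p hp => mem_range.2 (mem_filter.1 hp).2
      _ = p₀ := card_range p₀
  calc (#n.divisors : ℝ) = ∏ p ∈ n.primeFactors, (n.factorization p + 1 : ℝ) := by
        rw [Nat.card_divisors hn]
        push_cast
        rfl
    _ ≤ ∏ p ∈ n.primeFactors, (if p < p₀ then c else 1) * ((p : ℝ) ^ δ) ^ n.factorization p :=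
        prod_le_prod (fun _ _ => by positivity) hfactor
    _ = c ^ #{p ∈ n.primeFactors | p < p₀} * (n : ℝ) ^ δ := by
        rw [prod_mul_distrib, prod_primeFactors_rpow_pow hn, ← prod_filter, prod_const]
    _ ≤ c ^ p₀ * (n : ℝ) ^ δ := by gcongr

theorem eventually_divisorBound {η : ℝ} (hη : 0 < η) :
    ∀ᶠ N : ℝ in Filter.atTop, DivisorBound (N ^ 4) (N ^ η) := by
  obtain ⟨C, hdiv⟩ := exists_card_divisors_le (δ := η / 8) (by positivity)
  filter_upwards [(tendsto_rpow_atTop (half_pos hη)).eventually_ge_atTop C,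
    Filter.eventually_gt_atTop 0] with N hCN hN n hn
  calc (#n.divisors : ℝ) ≤ C * (n : ℝ) ^ (η / 8) := hdiv n
    _ ≤ N ^ (η / 2) * (N ^ 4) ^ (η / 8) := by gcongr
    _ = N ^ (η / 2 + 4 * (η / 8)) := by
      rw [Real.rpow_add hN, Real.rpow_mul hN.le]
      norm_cast
    _ = N ^ η := by ring_nf

end DivisorBound

theorem eventually_exists_le_two_pow {η : ℝ} (hη : 0 < η) :
    ∀ᶠ N : ℝ in Filter.atTop, ∃ J : ℕ, N ≤ 2 ^ J ∧ J + 2 ≤ N ^ η := by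
  filter_upwards [(isLittleO_log_rpow_atTop hη).bound (c := 1 / 10) (by norm_num),
    (tendsto_rpow_atTop hη).eventually_ge_atTop 1000, Filter.eventually_ge_atTop 1]
    with N hlogN hηN hN
  have hlog : 0 ≤ Real.log N := Real.log_nonneg hN
  rw [Real.norm_of_nonneg hlog, Real.norm_of_nonneg (by positivity)] at hlogN
  refine ⟨⌈Real.logb 2 N⌉₊, ?_, ?_⟩
  · calc N = (2 : ℝ) ^ Real.logb 2 N :=
          (Real.rpow_logb two_pos (by norm_num) (by positivity)).symm
      _ ≤ (2 : ℝ) ^ (⌈Real.logb 2 N⌉₊ : ℝ) :=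
          Real.rpow_le_rpow_of_exponent_le one_le_two (Nat.le_ceil _)
      _ = 2 ^ ⌈Real.logb 2 N⌉₊ := Real.rpow_natCast _ _
  · have hceil := Nat.ceil_lt_add_one (Real.logb_nonneg one_lt_two hN)
    have hlogb : Real.logb 2 N ≤ 2 * Real.log N := by
      rw [Real.logb, div_le_iff₀ (Real.log_pos one_lt_two)]
      nlinarith [Real.log_two_gt_d9]
    linarith

section Exponents

variable {A N P η θ μ x y : ℝ}

theorem le_rpow_add (hN : 0 < N) (hA : A ≤ N ^ η) (hx : x ≤ A * N ^ y) : x ≤ N ^ (η + y) := by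
  rw [Real.rpow_add hN]
  exact hx.trans (by gcongr)

theorem rpow_pow_mul_rpow_pow_mul_le (hN : 1 ≤ N) {k j : ℕ} (hx : x ≤ N ^ y)
    (hexp : k * η + j * μ + y ≤ θ) : (N ^ η) ^ k * (N ^ μ) ^ j * x ≤ N ^ θ := by
  have hN0 : 0 < N := by positivity
  calc (N ^ η) ^ k * (N ^ μ) ^ j * x ≤ (N ^ η) ^ k * (N ^ μ) ^ j * N ^ y := by gcongr
    _ = N ^ (k * η + j * μ + y) := by
      rw [Real.rpow_add hN0, Real.rpow_add hN0, mul_comm (k : ℝ), mul_comm (j : ℝ),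
        Real.rpow_mul_natCast hN0.le, Real.rpow_mul_natCast hN0.le]
    _ ≤ N ^ θ := Real.rpow_le_rpow_of_exponent_le hN hexp

theorem rpow_le_of_sqrt_mul_le (hN : 0 < N) (hA : A ≤ N ^ η) (hx : 0 ≤ x)
    (h : (2 * N ^ θ) ^ (1 / 2 : ℝ) * N ≤ A * x) : N ^ (1 + θ / 2 - η) ≤ x := by
  rw [Real.rpow_sub hN, div_le_iff₀' (by positivity)]
  calc N ^ (1 + θ / 2) = (N ^ θ) ^ (1 / 2 : ℝ) * N := by
        rw [add_comm, Real.rpow_add_one hN.ne', ← Real.rpow_mul hN.le, mul_one_div]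
    _ ≤ (2 * N ^ θ) ^ (1 / 2 : ℝ) * N := by
        gcongr
        exact le_mul_of_one_le_left (by positivity) one_le_two
    _ ≤ A * x := h
    _ ≤ N ^ η * x := by gcongr

theorem sq_le_of_le_mul_sqrt (hN : 1 ≤ N) (hA : A ≤ N ^ η) (hx : 0 ≤ x)
    (h : x ≤ A * ((2 * N ^ θ) ^ (1 / 2 : ℝ) * N)) (hexp : 2 * η + θ ≤ μ) :
    x ^ 2 ≤ 2 * N ^ μ * N ^ 2 :=
  calc x ^ 2 ≤ (N ^ η * (√(2 * N ^ θ) * N)) ^ 2 := by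
        rw [Real.sqrt_eq_rpow]
        gcongr
        exact h.trans (by gcongr)
    _ = 2 * ((N ^ η) ^ 2 * N ^ θ) * N ^ 2 := by
        rw [mul_pow, mul_pow, Real.sq_sqrt (by positivity)]
        ring
    _ ≤ 2 * N ^ μ * N ^ 2 := by
        gcongr
        simpa using rpow_pow_mul_rpow_pow_mul_le (j := 0) (μ := 0) (k := 2) hN le_rfl (by simpa)

end Exponents

/-- The ranges of `ρ`, `q`, `V` and `W` in the theorem, relative to `N` and with implied
constant `A`. -/
structure IsTypeIRange (ε A ρ N : ℝ) (q : ℕ) (V W : ℝ) : Prop where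
  lt_rho : 1 / 6 < ρ
  rho_lt : ρ < 2 / 11
  le_mul_q : (2 * N ^ (ρ - ε / 2)) ^ (1 / 2 : ℝ) * N ≤ A * q
  q_le_mul : q ≤ A * ((2 * N ^ (ρ - ε / 2)) ^ (1 / 2 : ℝ) * N)
  one_le_V : 1 ≤ V
  one_le_W : 1 ≤ W
  V_cube_mul_W_sq_le : V ^ 3 * W ^ 2 ≤ A * N ^ (2 - 3 * ρ)
  V_mul_W_cube_le : V * W ^ 3 ≤ A * N ^ (3 - 15 * ρ / 2)
  V_mul_W_le : V * W ≤ A * N ^ (2 - 8 * ρ)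

namespace IsTypeIRange

variable {ε η A ρ N V W : ℝ} {q : ℕ}

theorem W_le (h : IsTypeIRange ε A ρ N q V W) (hN : 1 ≤ N) (hη : 0 ≤ η) (hA : A ≤ N ^ η) :
    W ≤ N ^ (η + (1 - 5 * ρ / 2)) := by
  have hW := h.one_le_W
  refine le_of_pow_le_pow_left₀ three_ne_zero (by positivity) ?_
  calc W ^ 3 ≤ V * W ^ 3 := le_mul_of_one_le_left (by positivity) h.one_le_V
    _ ≤ N ^ (η + (3 - 15 * ρ / 2)) := le_rpow_add (by positivity) hA h.V_mul_W_cube_le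
    _ ≤ N ^ ((η + (1 - 5 * ρ / 2)) * (3 : ℕ)) :=
        Real.rpow_le_rpow_of_exponent_le hN (by push_cast; linarith)
    _ = (N ^ (η + (1 - 5 * ρ / 2))) ^ 3 := Real.rpow_mul_natCast (by positivity) _ _

theorem isAdmissible (h : IsTypeIRange ε A ρ N q V W) (hε : ε ≤ 1 / 10) (hη : 0 < η)
    (hηε : 10 ^ 8 * η ≤ ε) (hN : 1 ≤ N) (hA : A ≤ N ^ η) (hP : 1000 ≤ N ^ η)
    (hJ : ∃ J : ℕ, N ≤ 2 ^ J ∧ J + 2 ≤ N ^ η) (hdiv : DivisorBound (N ^ 4) (N ^ η)) :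
    IsAdmissible q N (N ^ (ρ - ε / 3)) V W (N ^ η) := by
  have hρ₁ := h.lt_rho
  have hρ₂ := h.rho_lt
  have hN0 : 0 < N := by positivity
  have hq : N ^ (1 + (ρ - ε / 2) / 2 - η) ≤ q :=
    rpow_le_of_sqrt_mul_le hN0 hA (Nat.cast_nonneg q) h.le_mul_q
  refine ⟨hP, hJ, hdiv, Real.one_le_rpow hN (by linarith), h.one_le_V, h.one_le_W, ?_, ?_,
    le_trans ?_ hq, le_trans ?_ hq, ?_⟩
  · exact (rpow_pow_mul_rpow_pow_mul_le hN (le_rpow_add hN0 hA h.V_mul_W_le)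
      (by push_cast; linarith)).trans_eq (Real.rpow_one N)
  · exact (rpow_pow_mul_rpow_pow_mul_le hN (le_rpow_add hN0 hA h.V_cube_mul_W_sq_le)
      (by push_cast; linarith)).trans_eq (Real.rpow_two N)
  · rw [← mul_one (_ * _)]
    exact rpow_pow_mul_rpow_pow_mul_le hN (Real.rpow_zero N).ge (by push_cast; linarith)
  · exact rpow_pow_mul_rpow_pow_mul_le hN (h.W_le hN hη.le hA) (by push_cast; linarith)
  · have hsq := sq_le_of_le_mul_sqrt hN hA (Nat.cast_nonneg q) h.q_le_mul
      (show _ ≤ ρ - ε / 3 by linarith)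
    refine hsq.trans ?_
    gcongr
    norm_num

theorem eventually_isAdmissible (A : ℝ) (hε : ε ≤ 1 / 10) (hη : 0 < η) (hηε : 10 ^ 8 * η ≤ ε) :
    ∀ᶠ N : ℝ in Filter.atTop, ∀ ⦃ρ : ℝ⦄ ⦃q : ℕ⦄ ⦃V W : ℝ⦄, IsTypeIRange ε A ρ N q V W →
      IsAdmissible q N (N ^ (ρ - ε / 3)) V W (N ^ η) := by
  filter_upwards [(tendsto_rpow_atTop hη).eventually_ge_atTop A,
    (tendsto_rpow_atTop hη).eventually_ge_atTop 1000, eventually_exists_le_two_pow hη,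
    eventually_divisorBound hη, Filter.eventually_ge_atTop 1]
    with N hA hP hJ hdiv hN ρ q V W h
  exact h.isAdmissible hε hη hηε hN hA hP hJ hdiv

theorem T_le (h : IsTypeIRange ε A ρ N q V W) (hε : 0 ≤ ε) (hA : 0 ≤ A) (hN : 1 ≤ N)
    (a : ℤ) (β γ : ℝ) (S : ℕ → Set ℝ) :
    T a q β γ N (N ^ (ρ - ε / 3)) V W S ≤ 4 * A * N ^ 4 := by
  have hρ₁ := h.lt_rho
  have hρ₂ := h.rho_lt
  have hV := h.one_le_V
  have hW := h.one_le_W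
  have hVW : V * W ≤ A * N ^ 2 :=
    h.V_mul_W_le.trans <| by
      rw [← Real.rpow_two N]
      gcongr
      linarith
  have hL : N ^ (ρ - ε / 3) ≤ N := Real.rpow_le_self_of_one_le hN (by linarith)
  calc T a q β γ N (N ^ (ρ - ε / 3)) V W S ≤ 4 * (V * W) * (N ^ (ρ - ε / 3) * N) :=
        T_le_mul a q β γ S (by positivity) (by positivity) (by positivity) (by positivity)
    _ ≤ 4 * (A * N ^ 2) * (N * N) := by gcongr
    _ = 4 * A * N ^ 4 := by ring

end IsTypeIRange

theorem T_le_of_isAdmissible_rpow {a : ℤ} {q : ℕ} {β γ N L V W η : ℝ} {S : ℕ → Set ℝ}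
    (h : IsAdmissible q N L V W (N ^ η)) (hq : 0 < q) (haq : IsCoprime a (q : ℤ))
    (hS : IsSubintervalFamily N S) : T a q β γ N L V W S ≤ N ^ (1 - 10 * η) := by
  obtain ⟨α, rfl, rfl⟩ : ∃ α : ℚ, α.num = a ∧ α.den = q :=
    ⟨⟨a, q, hq.ne', Int.isCoprime_iff_gcd_eq_one.1 haq⟩, rfl, rfl⟩
  have hN : 0 < N := by linarith [h.le_N]
  calc T α.num α.den β γ N L V W S ≤ N / (N ^ η) ^ 10 := h.T_le hS β γ
    _ = N ^ (1 - 10 * η) := by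
      rw [Real.rpow_sub hN, Real.rpow_one, mul_comm, Real.rpow_mul hN.le]
      norm_cast

end TypeI

theorem theorem2 :
    ∃ ε₀ : ℝ, 0 < ε₀ ∧ ∀ ε : ℝ, 0 < ε → ε < ε₀ → ∀ A : ℝ, 0 < A → ∃ C : ℝ, 0 < C ∧
      ∀ (ρ : ℝ), 1 / 6 < ρ → ρ < 2 / 11 →
      ∀ (a : ℤ) (q : ℕ), 0 < q → IsCoprime a (q : ℤ) →
      ∀ (β γ N : ℝ), 1 ≤ N →
      (2 * N ^ (ρ - ε / 2)) ^ (1 / 2 : ℝ) * N ≤ A * (q : ℝ) →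
      (q : ℝ) ≤ A * ((2 * N ^ (ρ - ε / 2)) ^ (1 / 2 : ℝ) * N) →
      ∀ (V W : ℝ), 1 ≤ V → 1 ≤ W →
      V ^ 3 * W ^ 2 ≤ A * N ^ (2 - 3 * ρ) →
      V * W ^ 3 ≤ A * N ^ (3 - 15 * ρ / 2) →
      V * W ≤ A * N ^ (2 - 8 * ρ) →
      ∀ (I : ℕ → Set ℝ), TypeI.IsSubintervalFamily N I →
      TypeI.T a q β γ N (N ^ (ρ - ε / 3)) V W I ≤ C * N ^ (1 - 10 * ε ^ 9) := by
  refine ⟨1 / 10, by norm_num, fun ε hε hε₀ A hA => ?_⟩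
  have hηε : 10 ^ 8 * ε ^ 9 ≤ ε :=
    calc 10 ^ 8 * ε ^ 9 = (10 * ε) ^ 8 * ε := by ring
      _ ≤ ε := mul_le_of_le_one_left hε.le (pow_le_one₀ (by positivity) (by linarith))
  obtain ⟨N₀, hN₀⟩ := Filter.eventually_atTop.1
    (TypeI.IsTypeIRange.eventually_isAdmissible A hε₀.le (by positivity) hηε)
  refine ⟨1 + 4 * A * N₀ ^ 4, by positivity, ?_⟩
  intro ρ hρ₁ hρ₂ a q hq haq β γ N hN hq₁ hq₂ V W hV hW h₁ h₂ h₃ I hI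
  have hrange : TypeI.IsTypeIRange ε A ρ N q V W := ⟨hρ₁, hρ₂, hq₁, hq₂, hV, hW, h₁, h₂, h₃⟩
  rcases lt_or_ge N N₀ with hlt | hge
  · calc TypeI.T a q β γ N (N ^ (ρ - ε / 3)) V W I ≤ 4 * A * N ^ 4 :=
          hrange.T_le hε.le hA.le hN a β γ I
      _ ≤ 1 + 4 * A * N₀ ^ 4 := by linarith [show 4 * A * N ^ 4 ≤ 4 * A * N₀ ^ 4 by gcongr]
      _ ≤ (1 + 4 * A * N₀ ^ 4) * N ^ (1 - 10 * ε ^ 9) :=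
          le_mul_of_one_le_right (by positivity) (Real.one_le_rpow hN (by linarith))
  · refine (TypeI.T_le_of_isAdmissible_rpow (hN₀ N hge hrange) hq haq hI).trans ?_
    exact le_mul_of_one_le_left (by positivity) (le_add_of_nonneg_right (by positivity))
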